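/- A chord diagram of order $n$ (an $n$-chord diagram) is an oriented circle with $2n$ distinct points paired into $n$ disjoint pairs, called chords, considered up to orientation-preserving diffeomorphism. Two chords intersect if their endpoints alternate around the circle. The $\mathfrak{sl}_2$ weight $\varphi(\mathcal D)\in\mathbb Z[x]$ of a chord diagram is defined by the Chmutov–Varchenko recursion: the weight of the empty diagram is $1$ (so the weight of the $1$-chord diagram is $x$), and for an $n$-chord diagram $\mathcal D$ with $n\ge 1$ and any chord $a$ of $\mathcal D$, $$\varphi(\mathcal D)=(x-k)\,\varphi(\mathcal D_a)+\sum_{\{i,j\}\subset I_a}\bigl(\varphi(\mathcal D^1_{i,j})-\varphi(\mathcal D^2_{i,j})\bigr).$$ Here $\mathcal D_a$ is $\mathcal D$ with the chord $a$ deleted; $I_a$ is the set of chords of $\mathcal D$ intersecting $a$, and $k=\#I_a$; the sum is over unordered pairs of distinct elements of $I_a$; for $i\in I_a$, $p_i$ denotes its endpoint on one fixed side of $a$ and $p_i^*$ its endpoint on the other side; and $\mathcal D^1_{i,j}$ (respectively $\mathcal D^2_{i,j}$) is obtained from $\mathcal D_a$ by replacing the chords $i,j$ by $(p_i,p_j)$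 and $(p_i^*,p_j^*)$ (respectively by $(p_i,p_j^*)$ and $(p_j,p_i^*)$). The chord $a$ may be chosen arbitrarily at every step of the recursion, and the statement below holds for all such choices. For an $n$-chord diagram $\mathcal D$ put $\varphi_{\mathfrak{sl}_2}(\mathcal D)(x)=2^n\,\varphi(\mathcal D)(x/2)$. For $n\ge 1$ let $\mathcal D_n=((i,n+i):1\le i\le n)$ be the $n$-chord diagram on the points $1,\dots,2n$ in which every two chords intersect, and let $D_n=\varphi(\mathcal D_n)$. Let $(g_{i,j})_{1\le j\le\lceil i/2\rceil}$ be the Seidel triangle, defined by $g_{1,1}=1$ and, for all $p\ge 1$, $g_{2p,j}=g_{2p-1,j}+g_{2p,j+1}$ for $1\le j\le p$ and $g_{2p+1,j}=g_{2p+1,j-1}+g_{2p,j}$ for $1\le j\le p+1$, where $g_{2p,p+1}=g_{2p+1,0}=0$. For $n\ge 0$ let $H_{2n+1}=g_{2n+2,1}$ be the median Genocchi numbers and $h_n=H_{2n+1}/2^n$ the normalized median Genocchi numbers. Then for every $n\ge 1$: the number $h_{n-1}$ is an integer, that is, $2^{n-1}$ divides $H_{2n-1}$; $$D_n\equiv(-1)^{n-1}h_{n-1}\,x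 \pmod{x^2};$$ and, equivalently, $$\varphi_{\mathfrak{sl}_2}(\mathcal D_n)\equiv(-1)^{n-1}H_{2n-1}\,x \pmod{x^2}.$$ -/

import Mathlib

open Polynomial

/-- A chord, recorded by its two endpoints `p < p*`.  The points of the oriented circle are
labelled by natural numbers, increasing along the orientation from a base point. -/
abbrev Chord : Type := ℕ × ℕ

/-- The chord with endpoints `p` and `q`, given in any order. -/
def mkChord (p q : ℕ) : Chord := (min p q, max p q)

/-- The finite set of chords `D` represents a chord diagram of order `n`: `n` chords with `2 n`
distinct endpoints.  Only the cyclic order of the endpoints is meaningful, so the labels are not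
required to be consecutive (and need not be renumbered when a chord is deleted). -/
structure IsChordDiagram (n : ℕ) (D : Finset Chord) : Prop where
  card_eq : D.card = n
  lt : ∀ c ∈ D, c.1 < c.2
  disjoint : ∀ c ∈ D, ∀ d ∈ D, c ≠ d →
    c.1 ≠ d.1 ∧ c.1 ≠ d.2 ∧ c.2 ≠ d.1 ∧ c.2 ≠ d.2

/-- The label `p` lies on the open arc going from the first to the second endpoint of `a`,
that is, on one fixed side of `a`. -/
def OnSide (a : Chord) (p : ℕ) : Prop := a.1 < p ∧ p < a.2

instance (a : Chord) (p : ℕ) : Decidable (OnSide a p) := by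
  unfold OnSide; infer_instance

/-- The chords `a` and `c` intersect: their endpoints alternate around the circle. -/
def Crosses (a c : Chord) : Prop :=
  (a.1 < c.1 ∧ c.1 < a.2 ∧ a.2 < c.2) ∨ (c.1 < a.1 ∧ a.1 < c.2 ∧ c.2 < a.2)

instance (a c : Chord) : Decidable (Crosses a c) := by
  unfold Crosses; infer_instance

/-- For a chord `c` crossing `a`, its endpoint on the chosen side of `a`. -/
def sideEnd (a c : Chord) : ℕ := if OnSide a c.1 then c.1 else c.2

/-- For a chord `c` crossing `a`, its endpoint on the other side of `a`. -/
def farEnd (a c : Chord) : ℕ := if OnSide a c.1 then c.2 else c.1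

/-- The set `I_a` of the chords of `D` that intersect `a`. -/
def crossing (D : Finset Chord) (a : Chord) : Finset Chord := D.filter (Crosses a)

/-- The pairs `{i, j}` of distinct chords crossing `a`, each listed once, in the order of the
first endpoints. -/
def crossingPairs (D : Finset Chord) (a : Chord) : Finset (Chord × Chord) :=
  (crossing D a ×ˢ crossing D a).filter fun q => q.1.1 < q.2.1

/-- Delete `a`, and replace the chords `i`, `j` by the chord joining their endpoints on one side
of `a` and the chord joining their endpoints on the other side of `a`. -/
def resolveOne (D : Finset Chord) (a i j : Chord) : Finset Chord :=
  insert (mkChord (sideEnd a i) (sideEnd a j))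
    (insert (mkChord (farEnd a i) (farEnd a j)) (((D.erase a).erase i).erase j))

/-- Delete `a`, and replace the chords `i`, `j` by the two chords that join the endpoint of one
of them on one side of `a` to the endpoint of the other one on the other side of `a`. -/
def resolveTwo (D : Finset Chord) (a i j : Chord) : Finset Chord :=
  insert (mkChord (sideEnd a i) (farEnd a j))
    (insert (mkChord (sideEnd a j) (farEnd a i)) (((D.erase a).erase i).erase j))

/-- A rule that selects a chord in every nonempty chord diagram. -/
def IsChordChoice (c : Finset Chord → Chord) : Prop :=
  ∀ (n : ℕ) (D : Finset Chord), IsChordDiagram (n + 1) D → c D ∈ D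

/-- The weight `φ(D)` of a chord diagram `D` of order `n`, computed by the Chmutov–Varchenko
recursion, with the chord `a` selected by `c` at every step.  The empty diagram has weight `1`,
so that the diagram with one chord has weight `x`. -/
noncomputable def weight (c : Finset Chord → Chord) : ℕ → Finset Chord → ℤ[X]
  | 0, _ => 1
  | n + 1, D =>
    (X - C ((crossing D (c D)).card : ℤ)) * weight c n (D.erase (c D)) +
      ∑ q ∈ crossingPairs D (c D),
        (weight c n (resolveOne D (c D) q.1 q.2) - weight c n (resolveTwo D (c D) q.1 q.2))

/-- The weight `φ_{sl₂}(D)(x) = 2 ^ n * φ(D)(x / 2)` of a chord diagram `D` of order `n`. -/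
noncomputable def sl2Weight (c : Finset Chord → Chord) (n : ℕ) (D : Finset Chord) : ℚ[X] :=
  C (2 ^ n : ℚ) * ((weight c n D).map (Int.castRingHom ℚ)).comp (C (1 / 2 : ℚ) * X)

/-- The diagram `((i, n + i) : 1 ≤ i ≤ n)`, in which every two chords intersect. -/
def completeDiagram (n : ℕ) : Finset Chord :=
  (Finset.Icc 1 n).image fun i => (i, n + i)

/-- The Seidel triangle `g_{i,j}`, `1 ≤ j ≤ ⌈i / 2⌉`, extended by `0`.  Its defining recurrences
are summed along the rows here: downwards in `j` from `g_{2p,p+1} = 0`, and upwards from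
`g_{2p+1,0} = 0`; see `seidel_even` and `seidel_odd`. -/
def seidel : ℕ → ℕ → ℕ
  | 0, _ => 0
  | 1, j => if j = 1 then 1 else 0
  | i + 2, j =>
    if 1 ≤ j ∧ j ≤ (i + 3) / 2 then
      if Even i then ∑ l ∈ Finset.Icc j ((i + 3) / 2), seidel (i + 1) l
      else ∑ l ∈ Finset.Icc 1 j, seidel (i + 1) l
    else 0

/-- `medianGenocchi n` is the median Genocchi number `H_{2n+1} = g_{2n+2,1}`. -/
def medianGenocchi (n : ℕ) : ℕ := seidel (2 * n + 2) 1

/-- The normalized median Genocchi number `h_n = H_{2n+1} / 2 ^ n`. -/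
def normalizedMedianGenocchi (n : ℕ) : ℕ := medianGenocchi n / 2 ^ n

/-! Helper facts: the definitions above have the expected properties. -/

theorem seidel_one_one : seidel 1 1 = 1 := by simp [seidel]

theorem seidel_even_top (p : ℕ) (hp : 1 ≤ p) : seidel (2 * p) (p + 1) = 0 := by
  obtain ⟨p, rfl⟩ := Nat.exists_eq_add_of_le' hp
  rw [show 2 * (p + 1) = 2 * p + 2 by ring, seidel, if_neg (by omega)]

theorem seidel_odd_zero (p : ℕ) (hp : 1 ≤ p) : seidel (2 * p + 1) 0 = 0 := by
  obtain ⟨p, rfl⟩ := Nat.exists_eq_add_of_le' hp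
  rw [show 2 * (p + 1) + 1 = (2 * p + 1) + 2 by ring, seidel, if_neg (by omega)]

theorem seidel_even (p j : ℕ) (hj : 1 ≤ j) (hjp : j ≤ p) :
    seidel (2 * p) j = seidel (2 * p - 1) j + seidel (2 * p) (j + 1) := by
  obtain ⟨p, rfl⟩ := Nat.exists_eq_add_of_le' (hj.trans hjp)
  have he : Even (2 * p) := even_two_mul p
  have hd : (2 * p + 3) / 2 = p + 1 := by omega
  rw [show 2 * (p + 1) = 2 * p + 2 by ring, show 2 * p + 2 - 1 = 2 * p + 1 by omega, seidel,
    seidel, if_pos (by omega), if_pos he, if_pos he, hd]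
  rw [← Finset.add_sum_Ioc_eq_sum_Icc hjp]
  congr 1
  split_ifs with h
  · exact Finset.sum_congr (by ext; simp) fun _ _ => rfl
  · rw [Finset.Ioc_eq_empty (by omega), Finset.sum_empty]

theorem seidel_odd (p j : ℕ) (hp : 1 ≤ p) (hj : 1 ≤ j) (hjp : j ≤ p + 1) :
    seidel (2 * p + 1) j = seidel (2 * p + 1) (j - 1) + seidel (2 * p) j := by
  obtain ⟨p, rfl⟩ := Nat.exists_eq_add_of_le' hp
  obtain ⟨j, rfl⟩ := Nat.exists_eq_add_of_le' hj
  have he : ¬ Even (2 * p + 1) := by simp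
  have hd : (2 * p + 1 + 3) / 2 = p + 2 := by omega
  rw [show 2 * (p + 1) + 1 = (2 * p + 1) + 2 by ring, show 2 * (p + 1) = 2 * p + 1 + 1 by ring,
    Nat.add_sub_cancel]
  conv_lhs => rw [seidel]
  rw [if_pos (by omega), if_neg he, Finset.sum_Icc_succ_top (by omega)]
  congr 1
  conv_rhs => rw [seidel]
  rw [if_neg he]
  split_ifs with h
  · rfl
  · rw [Finset.Icc_eq_empty (by omega), Finset.sum_empty]

theorem isChordDiagram_completeDiagram (n : ℕ) : IsChordDiagram n (completeDiagram n) where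
  card_eq := by
    rw [completeDiagram, Finset.card_image_of_injective _ fun i j h => (Prod.mk.inj h).1]
    simp
  lt := by
    simp only [completeDiagram, Finset.mem_image, Finset.mem_Icc]
    rintro _ ⟨i, hi, rfl⟩
    simp only
    omega
  disjoint := by
    simp only [completeDiagram, Finset.mem_image, Finset.mem_Icc]
    rintro _ ⟨i, hi, rfl⟩ _ ⟨j, hj, rfl⟩ h
    have : i ≠ j := fun e => h (by rw [e])
    simp only
    omega

theorem crosses_of_mem_completeDiagram (n : ℕ) (a : Chord) (ha : a ∈ completeDiagram n)
    (c : Chord) (hc : c ∈ completeDiagram n) (h : a ≠ c) : Crosses a c := by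
  simp only [completeDiagram, Finset.mem_image, Finset.mem_Icc] at ha hc
  obtain ⟨i, hi, rfl⟩ := ha
  obtain ⟨j, hj, rfl⟩ := hc
  have : i ≠ j := fun e => h (by rw [e])
  simp only [Crosses]
  omega

theorem exists_isChordChoice : ∃ c, IsChordChoice c := by
  classical
  refine ⟨fun D => if h : D.Nonempty then h.choose else (0, 0), fun n D hD => ?_⟩
  have h : D.Nonempty := Finset.card_pos.mp (by rw [hD.card_eq]; omega)
  simp only [dif_pos h]
  exact h.choose_spec

theorem IsChordDiagram.erase {n : ℕ} {D : Finset Chord} (hD : IsChordDiagram (n + 1) D)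
    {a : Chord} (ha : a ∈ D) : IsChordDiagram n (D.erase a) where
  card_eq := by rw [Finset.card_erase_of_mem ha, hD.card_eq]; rfl
  lt := fun c hc => hD.lt c (Finset.mem_of_mem_erase hc)
  disjoint := fun c hc d hd =>
    hD.disjoint c (Finset.mem_of_mem_erase hc) d (Finset.mem_of_mem_erase hd)

/-- Replacing two chords by two chords on the same four endpoints gives a chord diagram. -/
theorem IsChordDiagram.replace {n : ℕ} {D : Finset Chord} (hD : IsChordDiagram n D)
    {i j k l : Chord} (hi : i ∈ D) (hj : j ∈ D) (hij : i ≠ j) (hk : k.1 < k.2) (hl : l.1 < l.2)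
    (hkl : k.1 ≠ l.1 ∧ k.1 ≠ l.2 ∧ k.2 ≠ l.1 ∧ k.2 ≠ l.2)
    (hk1 : k.1 = i.1 ∨ k.1 = i.2 ∨ k.1 = j.1 ∨ k.1 = j.2)
    (hk2 : k.2 = i.1 ∨ k.2 = i.2 ∨ k.2 = j.1 ∨ k.2 = j.2)
    (hl1 : l.1 = i.1 ∨ l.1 = i.2 ∨ l.1 = j.1 ∨ l.1 = j.2)
    (hl2 : l.2 = i.1 ∨ l.2 = i.2 ∨ l.2 = j.1 ∨ l.2 = j.2) :
    IsChordDiagram n (insert k (insert l ((D.erase i).erase j))) := by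
  have key : ∀ d ∈ (D.erase i).erase j,
      (k.1 ≠ d.1 ∧ k.1 ≠ d.2 ∧ k.2 ≠ d.1 ∧ k.2 ≠ d.2) ∧
      (l.1 ≠ d.1 ∧ l.1 ≠ d.2 ∧ l.2 ≠ d.1 ∧ l.2 ≠ d.2) := by
    intro d hd
    simp only [Finset.mem_erase] at hd
    obtain ⟨a1, a2, a3, a4⟩ := hD.disjoint i hi d hd.2.2 (Ne.symm hd.2.1)
    obtain ⟨b1, b2, b3, b4⟩ := hD.disjoint j hj d hd.2.2 (Ne.symm hd.1)
    have aux : ∀ x, (x = i.1 ∨ x = i.2 ∨ x = j.1 ∨ x = j.2) → x ≠ d.1 ∧ x ≠ d.2 := by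
      rintro x (rfl | rfl | rfl | rfl)
      exacts [⟨a1, a2⟩, ⟨a3, a4⟩, ⟨b1, b2⟩, ⟨b3, b4⟩]
    exact ⟨⟨(aux _ hk1).1, (aux _ hk1).2, (aux _ hk2).1, (aux _ hk2).2⟩,
      ⟨(aux _ hl1).1, (aux _ hl1).2, (aux _ hl2).1, (aux _ hl2).2⟩⟩
  have hlD : l ∉ (D.erase i).erase j := fun h => (key l h).2.1 rfl
  have hkD : k ∉ insert l ((D.erase i).erase j) := by
    rw [Finset.mem_insert, not_or]
    exact ⟨fun h => hkl.1 (by rw [h]), fun h => (key k h).1.1 rfl⟩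
  have hj' : j ∈ D.erase i := Finset.mem_erase.mpr ⟨hij.symm, hj⟩
  refine ⟨?_, ?_, ?_⟩
  · have h2 : 2 ≤ D.card := by
      have := Finset.card_pos.mpr ⟨j, hj'⟩
      rw [Finset.card_erase_of_mem hi] at this
      omega
    rw [Finset.card_insert_of_notMem hkD, Finset.card_insert_of_notMem hlD,
      Finset.card_erase_of_mem hj', Finset.card_erase_of_mem hi, ← hD.card_eq]
    omega
  · intro c hc
    simp only [Finset.mem_insert] at hc
    rcases hc with rfl | rfl | hc
    · exact hk
    · exact hl
    · simp only [Finset.mem_erase] at hc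
      exact hD.lt c hc.2.2
  · intro c hc d hd hcd
    simp only [Finset.mem_insert] at hc hd
    rcases hc with rfl | rfl | hc <;> rcases hd with rfl | rfl | hd
    · exact absurd rfl hcd
    · exact hkl
    · exact (key d hd).1
    · exact ⟨hkl.1.symm, hkl.2.2.1.symm, hkl.2.1.symm, hkl.2.2.2.symm⟩
    · exact absurd rfl hcd
    · exact (key d hd).2
    · obtain ⟨h1, h2, h3, h4⟩ := (key c hc).1
      exact ⟨h1.symm, h3.symm, h2.symm, h4.symm⟩
    · obtain ⟨h1, h2, h3, h4⟩ := (key c hc).2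
      exact ⟨h1.symm, h3.symm, h2.symm, h4.symm⟩
    · simp only [Finset.mem_erase] at hc hd
      exact hD.disjoint c hc.2.2 d hd.2.2 hcd

theorem isChordDiagram_resolve {n : ℕ} {D : Finset Chord} (hD : IsChordDiagram (n + 1) D)
    {a : Chord} (ha : a ∈ D) {q : Chord × Chord} (hq : q ∈ crossingPairs D a) :
    IsChordDiagram n (resolveOne D a q.1 q.2) ∧ IsChordDiagram n (resolveTwo D a q.1 q.2) := by
  obtain ⟨i, j⟩ := q
  simp only [crossingPairs, crossing, Finset.mem_filter, Finset.mem_product] at hq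
  obtain ⟨⟨⟨hi, hai⟩, ⟨hj, haj⟩⟩, hlt⟩ := hq
  have hij : i ≠ j := fun e => by rw [e] at hlt; exact lt_irrefl _ hlt
  have hne : ∀ c, Crosses a c → c ≠ a := by
    rintro c hc rfl
    simp only [Crosses] at hc
    omega
  have hi' : i ∈ D.erase a := Finset.mem_erase.mpr ⟨hne i hai, hi⟩
  have hj' : j ∈ D.erase a := Finset.mem_erase.mpr ⟨hne j haj, hj⟩
  have hd := hD.disjoint i hi j hj hij
  have h1 := hD.lt i hi
  have h2 := hD.lt j hj
  have hse : ∀ c : Chord, (sideEnd a c = c.1 ∧ farEnd a c = c.2) ∨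
      (sideEnd a c = c.2 ∧ farEnd a c = c.1) := by
    intro c
    by_cases h : OnSide a c.1 <;> simp [sideEnd, farEnd, h]
  have hm : ∀ x y : ℕ, ((mkChord x y).1 = x ∧ (mkChord x y).2 = y ∧ x ≤ y) ∨
      ((mkChord x y).1 = y ∧ (mkChord x y).2 = x ∧ y ≤ x) := by
    intro x y
    simp only [mkChord]
    omega
  have main : ∀ x y z t : ℕ,
      (x = i.1 ∧ z = i.2 ∨ x = i.2 ∧ z = i.1) → (y = j.1 ∧ t = j.2 ∨ y = j.2 ∧ t = j.1) →
      IsChordDiagram n (insert (mkChord x y)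
        (insert (mkChord z t) (((D.erase a).erase i).erase j))) ∧
      IsChordDiagram n (insert (mkChord x y)
        (insert (mkChord t z) (((D.erase a).erase i).erase j))) := by
    intro x y z t hx hy
    have hc : mkChord t z = mkChord z t := by simp only [mkChord, min_comm, max_comm]
    rw [hc, and_self]
    generalize hk : mkChord x y = k
    generalize hl : mkChord z t = l
    have hk' := hm x y
    have hl' := hm z t
    rw [hk] at hk'
    rw [hl] at hl'
    clear hk hl hm hc
    apply (hD.erase ha).replace hi' hj' hij <;> clear hne hai haj <;> omega
  have ei := hse i
  have ej := hse j
  exact ⟨(main _ _ _ _ ei ej).1, (main _ _ _ _ ei (ej.symm.imp And.symm And.symm)).2⟩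

/-! The weight is realized by spin operators. Given `S 0, S 1, S 2` with the spin commutation
relations and scalar Casimir `x`, label the points of a diagram by `Fin 3`, equally on the two ends
of each chord, and sum the products of the operators read along the circle from the base point.
Moving the operators at the ends of one chord together produces commutators, and the contraction of
two epsilon tensors turns every pair of commutators into a difference of two reconnections. Hence
these sums satisfy the Chmutov–Varchenko recursion for every chord
(`IsSpinTriple.wordSum_recursion`), and they equal the weight at `x` for every choice of chords
(`IsSpinTriple.wordSum_eq_weight`).

For the complete diagram the sum is a contraction of the `n`-th power of the tensor Casimir `∑ S t ⊗
S t`. For any complex `j`, spin `j` acts on polynomials by differential operators with Casimir `j (j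
+ 1)`. The tensor Casimir sends the vector `(u - v) ^ k ∂ ^ k` to a combination of itself and its
successor (`casimirOp_relVec`), and the contraction of this vector is `(-1) ^ k k!`
(`evalAct_relVec`). The weight at `j (j + 1)` is thus computed by the two-term recursion
`spinMoment` (`weight_completeDiagram_comp`). As `j (j + 1)` agrees with `j` to first order, the
linear coefficient in `x` is the linear coefficient in `j`. At `j = 0` the recursion becomes the
integer recursion `signedGenocchi`.

On the Seidel side, let `L` be the functional with `L (f (X) + f (X + 1)) = f' (0)`. It kills every
polynomial invariant under `X ↦ -1 - X`, so its values on `X ^ i (X + 1) ^ j` obey the rules and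
boundary conditions of the Seidel triangle up to sign (`seidel_eq_genocchiTable`). Repeated
multiplication by `X (X + 1)`, expressed through central factorials, gives the recursion of
`signedGenocchi` with an extra factor `2` at each step
(`genocchiFunctional_pow_mul_centralFactorial`). This identifies the two sides and proves the
divisibility. -/

/-! ### Words in spin operators and their commutators. -/

/-- Three elements of a complex algebra that satisfy the commutation relations of spin operators,
with scalar Casimir element `x`. -/
structure IsSpinTriple {A : Type*} [Ring A] [Algebra ℂ A] (S : Fin 3 → A) (x : ℂ) : Prop where
  comm01 : S 0 * S 1 - S 1 * S 0 = Complex.I • S 2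
  comm12 : S 1 * S 2 - S 2 * S 1 = Complex.I • S 0
  comm20 : S 2 * S 0 - S 0 * S 2 = Complex.I • S 1
  casimir : ∑ t, S t * S t = x • (1 : A)

/-- The product of the letters `φ p` along a list of positions. -/
def word {A : Type*} [Ring A] (φ : ℕ → A) (l : List ℕ) : A := (l.map φ).prod

/-- The word along `l` as a linear function of its letter at the position `q`. -/
def wordSubst {A : Type*} [Ring A] [Algebra ℂ A] (φ : ℕ → A) : List ℕ → ℕ → A →ₗ[ℂ] A
  | [], _ => 0
  | p :: l, q => if p = q then LinearMap.mulRight ℂ (word φ l)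
      else LinearMap.mulLeft ℂ (φ p) ∘ₗ wordSubst φ l q

/-- The labelling `ℓ` with the labels at `p` and `q` replaced by `s` and `t`. -/
def relabel (ℓ : ℕ → Fin 3) (p q : ℕ) (s t : Fin 3) : ℕ → Fin 3 :=
  Function.update (Function.update ℓ p s) q t

section Words

variable {A : Type*} [Ring A]

@[simp] theorem word_nil (φ : ℕ → A) : word φ [] = 1 := rfl

@[simp] theorem word_cons (φ : ℕ → A) (p : ℕ) (l : List ℕ) :
    word φ (p :: l) = φ p * word φ l := by simp [word]

theorem word_append (φ : ℕ → A) (l m : List ℕ) : word φ (l ++ m) = word φ l * word φ m := by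
  simp [word]

theorem word_congr {φ ψ : ℕ → A} {l : List ℕ} (h : ∀ p ∈ l, φ p = ψ p) :
    word φ l = word ψ l := by
  rw [word, word, List.map_congr_left h]

/-- The local term of the pair of positions `p`, `q` in the expansion of `∑ a, S a * M * S a`. -/
def pairTerm (S : Fin 3 → A) (l : List ℕ) (ℓ : ℕ → Fin 3) (p q : ℕ) : A :=
  (if ℓ p = ℓ q then ∑ c, word (S ∘ relabel ℓ p q c c) l else 0) -
    word (S ∘ relabel ℓ p q (ℓ q) (ℓ p)) l

theorem relabel_comm (ℓ : ℕ → Fin 3) {p q : ℕ} (hpq : p ≠ q) (s t : Fin 3) :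
    relabel ℓ p q s t = relabel ℓ q p t s := Function.update_comm hpq _ _ _

theorem pairTerm_comm (S : Fin 3 → A) (l : List ℕ) (ℓ : ℕ → Fin 3) {p q : ℕ} (hpq : p ≠ q) :
    pairTerm S l ℓ p q = pairTerm S l ℓ q p := by
  simp only [pairTerm, relabel_comm ℓ hpq, eq_comm]

theorem relabel_of_ne (ℓ : ℕ → Fin 3) {p q r : ℕ} (hp : r ≠ p) (hq : r ≠ q) (s t : Fin 3) :
    relabel ℓ p q s t r = ℓ r := by
  rw [relabel, Function.update_of_ne hq, Function.update_of_ne hp]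

theorem relabel_left (ℓ : ℕ → Fin 3) {p q : ℕ} (hpq : p ≠ q) (s t : Fin 3) :
    relabel ℓ p q s t p = s := by
  rw [relabel, Function.update_of_ne hpq, Function.update_self]

theorem relabel_right (ℓ : ℕ → Fin 3) (p q : ℕ) (s t : Fin 3) :
    relabel ℓ p q s t q = t := by
  rw [relabel, Function.update_self]

theorem pairTerm_append (S : Fin 3 → A) (l m k : List ℕ) (ℓ : ℕ → Fin 3) {p q : ℕ}
    (hpl : p ∉ l) (hql : q ∉ l) (hpk : p ∉ k) (hqk : q ∉ k) :
    word (S ∘ ℓ) l * pairTerm S m ℓ p q * word (S ∘ ℓ) k = pairTerm S (l ++ (m ++ k)) ℓ p q := by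
  have h : ∀ s t, word (S ∘ relabel ℓ p q s t) (l ++ (m ++ k)) =
      word (S ∘ ℓ) l * word (S ∘ relabel ℓ p q s t) m * word (S ∘ ℓ) k := by
    intro s t
    rw [word_append, word_append, mul_assoc]
    congr 1
    · exact word_congr fun r hr => congrArg S
        (relabel_of_ne _ (ne_of_mem_of_not_mem hr hpl) (ne_of_mem_of_not_mem hr hql) _ _)
    · congr 1
      exact word_congr fun r hr => congrArg S
        (relabel_of_ne _ (ne_of_mem_of_not_mem hr hpk) (ne_of_mem_of_not_mem hr hqk) _ _)
  simp only [pairTerm, h]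
  split_ifs
  · simp only [mul_sub, sub_mul, Finset.mul_sum, Finset.sum_mul]
  · simp

variable [Algebra ℂ A]

theorem wordSubst_apply (φ : ℕ → A) {l : List ℕ} (hl : l.Nodup) {q : ℕ} (hq : q ∈ l) (v : A) :
    wordSubst φ l q v = word (Function.update φ q v) l := by
  induction l with
  | nil => simp at hq
  | cons p l ih =>
    rw [List.nodup_cons] at hl
    by_cases hpq : p = q
    · subst hpq
      have : word (Function.update φ p v) l = word φ l :=
        word_congr fun r hr => Function.update_of_ne (ne_of_mem_of_not_mem hr hl.1) _ _
      simp [wordSubst, this]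
    · have hq' : q ∈ l := by simpa [Ne.symm hpq] using hq
      simp [wordSubst, hpq, ih hl.2 hq']

/-- The Leibniz rule: commutation with `s` is a derivation, so it acts on one letter at a time. -/
theorem word_mul_sub_mul_word (φ : ℕ → A) {l : List ℕ} (hl : l.Nodup) (s : A) :
    word φ l * s - s * word φ l =
      ∑ q ∈ l.toFinset, wordSubst φ l q (φ q * s - s * φ q) := by
  induction l with
  | nil => simp
  | cons p l ih =>
    rw [List.nodup_cons] at hl
    have hp : p ∉ l.toFinset := by simpa using hl.1
    rw [List.toFinset_cons, Finset.sum_insert hp]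
    have h : ∀ q ∈ l.toFinset, wordSubst φ (p :: l) q (φ q * s - s * φ q) =
        φ p * wordSubst φ l q (φ q * s - s * φ q) := by
      intro q hq
      have : p ≠ q := fun h => hp (h ▸ hq)
      simp [wordSubst, this]
    rw [Finset.sum_congr rfl h, ← Finset.mul_sum, ← ih hl.2]
    simp only [word_cons, wordSubst, if_true, LinearMap.mulRight_apply]
    noncomm_ring

variable {S : Fin 3 → A} {x : ℂ}

/-- With `[S a, S b] = i ε_{abc} S c`, antisymmetry in `a, c` produces half a second commutator, and
the double contraction of epsilons is `2 δ`. This is the source of the `-1` per letter in the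
coefficient `x - k`. -/
theorem IsSpinTriple.sum_comm_mul_self (hS : IsSpinTriple S x) (b : Fin 3) :
    ∑ a, (S a * S b - S b * S a) * S a = - S b := by
  have h01 := hS.comm01
  have h12 := hS.comm12
  have h20 := hS.comm20
  have h10 : S 1 * S 0 - S 0 * S 1 = -(Complex.I • S 2) := by rw [← h01]; abel
  have h21 : S 2 * S 1 - S 1 * S 2 = -(Complex.I • S 0) := by rw [← h12]; abel
  have h02 : S 0 * S 2 - S 2 * S 0 = -(Complex.I • S 1) := by rw [← h20]; abel
  have key : ∀ u : A, Complex.I • (Complex.I • u) = -u := fun u => by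
    rw [smul_smul, Complex.I_mul_I, neg_one_smul]
  fin_cases b <;>
    simp only [Fin.sum_univ_three, Fin.zero_eta, Fin.mk_one, Fin.reduceFinMk, h01, h12, h20, h10,
      h21, h02, sub_self, zero_mul, neg_mul, smul_mul_assoc]
  · rw [zero_add, ← key (S 0), ← h12, smul_sub]; abel
  · rw [add_zero, ← key (S 1), ← h20, smul_sub]; abel
  · rw [add_zero, ← key (S 2), ← h01, smul_sub]; abel

/-- The contraction `∑ ε_{abc} ε_{aed} = δ_{be} δ_{cd} - δ_{bd} δ_{ce}`, with the sign `i ^ 2 = -1`.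
The two products of deltas become the two reconnections in the recursion. The map `f` is the rest of
a word as a function of its second open letter. -/
theorem IsSpinTriple.sum_comm_mul_map_comm (hS : IsSpinTriple S x) (f : A →ₗ[ℂ] A)
    (b d : Fin 3) :
    ∑ a, (S a * S b - S b * S a) * f (S d * S a - S a * S d) =
      (if b = d then ∑ c, S c * f (S c) else 0) - S d * f (S b) := by
  have h01 := hS.comm01
  have h12 := hS.comm12
  have h20 := hS.comm20
  have h10 : S 1 * S 0 - S 0 * S 1 = -(Complex.I • S 2) := by rw [← h01]; abel
  have h21 : S 2 * S 1 - S 1 * S 2 = -(Complex.I • S 0) := by rw [← h12]; abel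
  have h02 : S 0 * S 2 - S 2 * S 0 = -(Complex.I • S 1) := by rw [← h20]; abel
  have key : ∀ u : A, Complex.I • (Complex.I • u) = -u := fun u => by
    rw [smul_smul, Complex.I_mul_I, neg_one_smul]
  fin_cases b <;> fin_cases d <;>
    simp only [Fin.sum_univ_three, Fin.zero_eta, Fin.mk_one, Fin.reduceFinMk, h01, h12, h20, h10,
      h21, h02, sub_self, map_zero, map_neg, map_smul, mul_zero, zero_mul, mul_neg, neg_mul,
      smul_mul_assoc, mul_smul_comm, key, Fin.reduceEq, if_true, if_false, neg_neg,
      smul_neg, smul_zero] <;>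
    abel

theorem pairTerm_cons_head (S : Fin 3 → A) {l : List ℕ} (hl : l.Nodup) (ℓ : ℕ → Fin 3) {p q : ℕ}
    (hp : p ∉ l) (hq : q ∈ l) :
    (if ℓ p = ℓ q then ∑ c, S c * wordSubst (S ∘ ℓ) l q (S c) else 0) -
      S (ℓ q) * wordSubst (S ∘ ℓ) l q (S (ℓ p)) = pairTerm S (p :: l) ℓ p q := by
  have hpq : p ≠ q := fun h => hp (h ▸ hq)
  have h : ∀ s t, word (S ∘ relabel ℓ p q s t) (p :: l) =
      S s * wordSubst (S ∘ ℓ) l q (S t) := by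
    intro s t
    rw [word_cons, wordSubst_apply _ hl hq, Function.comp_apply, relabel_left _ hpq]
    congr 1
    refine word_congr fun r hr => ?_
    rw [← Function.comp_update, Function.comp_apply, Function.comp_apply, relabel]
    congr 1
    by_cases hrq : r = q
    · subst hrq; simp
    · rw [Function.update_of_ne hrq, Function.update_of_ne hrq,
        Function.update_of_ne (ne_of_mem_of_not_mem hr hp)]
  simp only [pairTerm, h]

/-- Induction on the word, moving the left `S a` past the head letter until the empty word leaves
the Casimir. The factor `2` lets each unordered pair of letters appear in both orders, so no order
has to be chosen on the positions. -/
theorem IsSpinTriple.two_mul_sum_mul_word_mul (hS : IsSpinTriple S x) {l : List ℕ} (hl : l.Nodup)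
    (ℓ : ℕ → Fin 3) :
    2 * ∑ a, S a * word (S ∘ ℓ) l * S a =
      (2 * (x - l.length)) • word (S ∘ ℓ) l +
        ∑ p ∈ l.toFinset, ∑ q ∈ l.toFinset, if p = q then 0 else pairTerm S l ℓ p q := by
  induction l with
  | nil =>
    simp only [word_nil, mul_one, hS.casimir, List.toFinset_nil, Finset.sum_empty, add_zero,
      List.length_nil, Nat.cast_zero, sub_zero, mul_smul]
    rw [two_mul, ofNat_smul_eq_nsmul, two_nsmul]
  | cons p l ih =>
    rw [List.nodup_cons] at hl
    have hp : p ∉ l.toFinset := by simpa using hl.1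
    have ih := ih hl.2
    set M := word (S ∘ ℓ) l with hM
    -- The commutator of `S a` with the head letter leaves `[S a, S (ℓ p)] M S a`. Writing `M S a =
    -- S a M + [M, S a]`, the first part collapses to `-S (ℓ p) M`, and the second, by the Leibniz
    -- rule, pairs the head with each later letter.
    have h1 : ∑ a, S a * word (S ∘ ℓ) (p :: l) * S a = S (ℓ p) * ∑ a, S a * M * S a +
        ((- S (ℓ p)) * M + ∑ q ∈ l.toFinset, pairTerm S (p :: l) ℓ p q) := by
      rw [← hS.sum_comm_mul_self (ℓ p)]
      have : ∀ q ∈ l.toFinset, pairTerm S (p :: l) ℓ p q = ∑ a, (S a * S (ℓ p) - S (ℓ p) * S a) *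
          wordSubst (S ∘ ℓ) l q (S (ℓ q) * S a - S a * S (ℓ q)) := by
        intro q hq
        rw [hS.sum_comm_mul_map_comm, pairTerm_cons_head S hl.2 ℓ hl.1 (by simpa using hq)]
      rw [Finset.sum_congr rfl this, Finset.sum_comm, Finset.sum_mul, Finset.mul_sum,
        ← Finset.sum_add_distrib, ← Finset.sum_add_distrib]
      refine Finset.sum_congr rfl fun a _ => ?_
      rw [← Finset.mul_sum]
      have h2 := word_mul_sub_mul_word (S ∘ ℓ) hl.2 (S a)
      simp only [Function.comp_apply] at h2
      rw [← h2, word_cons, ← hM]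
      simp only [Function.comp_apply]
      noncomm_ring
    have h3 : ∀ p' ∈ l.toFinset, ∀ q ∈ l.toFinset,
        (if p' = q then 0 else pairTerm S (p :: l) ℓ p' q) =
          S (ℓ p) * (if p' = q then 0 else pairTerm S l ℓ p' q) := by
      intro p' hp' q hq
      have e1 : p' ≠ p := fun h => hp (h ▸ hp')
      have e2 : q ≠ p := fun h => hp (h ▸ hq)
      have := pairTerm_append S [p] l [] ℓ (p := p') (q := q) (by simpa) (by simpa) (by simp)
        (by simp)
      simp only [word_cons, word_nil, mul_one, List.append_nil, List.singleton_append,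
        Function.comp_apply] at this
      rw [← this, mul_ite, mul_zero]
    have h4 : ∀ q ∈ l.toFinset, (if p = q then 0 else pairTerm S (p :: l) ℓ p q) =
        pairTerm S (p :: l) ℓ p q := fun q hq => if_neg (ne_of_mem_of_not_mem hq hp).symm
    have h5 : ∀ q ∈ l.toFinset, (if q = p then 0 else pairTerm S (p :: l) ℓ q p) =
        pairTerm S (p :: l) ℓ p q := fun q hq => by
      have : q ≠ p := fun h => hp (h ▸ hq)
      rw [if_neg this, pairTerm_comm _ _ _ this]
    rw [h1, List.toFinset_cons, Finset.sum_insert hp, Finset.sum_insert hp, if_pos rfl,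
      Finset.sum_congr rfl h4]
    have h6 : ∀ p' ∈ l.toFinset, ∑ q ∈ insert p l.toFinset,
        (if p' = q then 0 else pairTerm S (p :: l) ℓ p' q) = pairTerm S (p :: l) ℓ p p' +
        S (ℓ p) * ∑ q ∈ l.toFinset, (if p' = q then 0 else pairTerm S l ℓ p' q) := by
      intro p' hp'
      rw [Finset.sum_insert hp, h5 p' hp', Finset.sum_congr rfl (h3 p' hp'), Finset.mul_sum]
    rw [Finset.sum_congr rfl h6, Finset.sum_add_distrib, ← Finset.mul_sum, mul_add,
      ← mul_assoc, ← (Commute.ofNat_left 2 (S (ℓ p))).eq.symm]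
    have h7 : S (ℓ p) * 2 * ∑ a, S a * M * S a = S (ℓ p) * (2 * ∑ a, S a * M * S a) := mul_assoc _ _ _
    rw [h7, ih, word_cons, ← hM, Function.comp_apply, mul_add, mul_smul_comm, List.length_cons,
      Nat.cast_succ]
    have h8 : (2 * (x - (l.length + 1 : ℂ))) • (S (ℓ p) * M) =
        (2 * (x - l.length)) • (S (ℓ p) * M) - 2 * (S (ℓ p) * M) := by
      rw [show 2 * (x - (l.length + 1 : ℂ)) = 2 * (x - l.length) - 2 by ring, sub_smul,
        ofNat_smul_eq_nsmul, two_nsmul, ← two_mul (S (ℓ p) * M)]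
    rw [h8]
    noncomm_ring

end Words

/-! ### Labellings of chord diagrams and reconnection of two chords. -/

/-- The labellings of the points of `P` that are constant on the chords of `D`. -/
def IsLabelling (P : Finset ℕ) (D : Finset Chord) (ℓ : ℕ → Fin 3) : Prop :=
  (∀ p, p ∉ P → ℓ p = 0) ∧ ∀ c ∈ D, ℓ c.1 = ℓ c.2

theorem finite_isLabelling (P : Finset ℕ) (D : Finset Chord) :
    {ℓ : ℕ → Fin 3 | IsLabelling P D ℓ}.Finite := by
  refine Set.Finite.of_finite_image (f := fun ℓ (p : P) => ℓ p) (Set.toFinite _) ?_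
  intro ℓ hℓ m hm h
  funext p
  by_cases hp : p ∈ P
  · exact congrFun h ⟨p, hp⟩
  · rw [hℓ.1 p hp, hm.1 p hp]

/-- The finite set of the labellings of `P` that are constant on the chords of `D`. -/
noncomputable def labellings (P : Finset ℕ) (D : Finset Chord) : Finset (ℕ → Fin 3) :=
  (finite_isLabelling P D).toFinset

theorem mem_labellings {P : Finset ℕ} {D : Finset Chord} {ℓ : ℕ → Fin 3} :
    ℓ ∈ labellings P D ↔ (∀ p, p ∉ P → ℓ p = 0) ∧ ∀ c ∈ D, ℓ c.1 = ℓ c.2 := by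
  simp [labellings, IsLabelling]

theorem labellings_congr {P : Finset ℕ} {D E : Finset Chord}
    (h : ∀ ℓ : ℕ → Fin 3, (∀ c ∈ D, ℓ c.1 = ℓ c.2) ↔ ∀ c ∈ E, ℓ c.1 = ℓ c.2) :
    labellings P D = labellings P E := by
  ext ℓ
  rw [mem_labellings, mem_labellings, h]

/-- The endpoints of the chords of `D`. -/
def chordEnds (D : Finset Chord) : Finset ℕ := D.image Prod.fst ∪ D.image Prod.snd

theorem mem_chordEnds {D : Finset Chord} {p : ℕ} :
    p ∈ chordEnds D ↔ ∃ c ∈ D, p = c.1 ∨ p = c.2 := by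
  simp only [chordEnds, Finset.mem_union, Finset.mem_image]
  constructor
  · rintro (⟨c, hc, rfl⟩ | ⟨c, hc, rfl⟩)
    exacts [⟨c, hc, .inl rfl⟩, ⟨c, hc, .inr rfl⟩]
  · rintro ⟨c, hc, rfl | rfl⟩
    exacts [.inl ⟨c, hc, rfl⟩, .inr ⟨c, hc, rfl⟩]

theorem fst_mem_chordEnds {D : Finset Chord} {c : Chord} (hc : c ∈ D) : c.1 ∈ chordEnds D :=
  mem_chordEnds.mpr ⟨c, hc, .inl rfl⟩

theorem snd_mem_chordEnds {D : Finset Chord} {c : Chord} (hc : c ∈ D) : c.2 ∈ chordEnds D :=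
  mem_chordEnds.mpr ⟨c, hc, .inr rfl⟩

theorem relabel_chord {R : Finset Chord} {p q : ℕ} (hp : p ∉ chordEnds R) (hq : q ∉ chordEnds R)
    (ℓ : ℕ → Fin 3) (s t : Fin 3) {c : Chord} (hc : c ∈ R) :
    relabel ℓ p q s t c.1 = ℓ c.1 ∧ relabel ℓ p q s t c.2 = ℓ c.2 := by
  have h1 := fst_mem_chordEnds hc
  have h2 := snd_mem_chordEnds hc
  exact ⟨relabel_of_ne _ (ne_of_mem_of_not_mem h1 hp) (ne_of_mem_of_not_mem h1 hq) _ _,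
    relabel_of_ne _ (ne_of_mem_of_not_mem h2 hp) (ne_of_mem_of_not_mem h2 hq) _ _⟩

theorem relabel_relabel (ℓ : ℕ → Fin 3) (p q : ℕ) (s t s' t' : Fin 3) :
    relabel (relabel ℓ p q s t) p q s' t' = relabel ℓ p q s' t' := by
  funext r
  simp only [relabel, Function.update_apply]
  split_ifs <;> rfl

theorem relabel_self (ℓ : ℕ → Fin 3) {p q : ℕ} {s t : Fin 3} (hs : s = ℓ p) (ht : t = ℓ q) :
    relabel ℓ p q s t = ℓ := by
  funext r
  simp only [relabel, Function.update_apply]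
  split_ifs with h1 h2
  · rw [ht, h1]
  · rw [hs, h2]
  · rfl

theorem sum_labellings_insert {M : Type*} [AddCommMonoid M] {P : Finset ℕ} {R : Finset Chord}
    {p q : ℕ} (hpq : p ≠ q) (hpP : p ∈ P) (hqP : q ∈ P) (hp : p ∉ chordEnds R)
    (hq : q ∉ chordEnds R) (f : (ℕ → Fin 3) → M) :
    ∑ ℓ ∈ labellings P (insert (p, q) R), f ℓ =
      ∑ ℓ ∈ labellings ((P.erase p).erase q) R, ∑ t, f (relabel ℓ p q t t) := by
  rw [← Finset.sum_product']
  -- Labels off the point set are pinned to `0`, so forgetting the chord resets both its ends to `0`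
  -- and keeps their common label separately.
  refine Finset.sum_nbij' (fun ℓ => (relabel ℓ p q 0 0, ℓ p)) (fun x => relabel x.1 p q x.2 x.2)
    ?_ ?_ ?_ ?_ ?_
  · intro ℓ hℓ
    simp only [mem_labellings, Finset.mem_insert, forall_eq_or_imp] at hℓ
    simp only [Finset.mem_product, mem_labellings, Finset.mem_univ, and_true, Finset.mem_erase]
    refine ⟨fun r hr => ?_, fun c hc => ?_⟩
    · by_cases h1 : r = p
      · rw [h1, relabel_left _ hpq]
      by_cases h2 : r = q
      · rw [h2, relabel_right]
      rw [relabel_of_ne _ h1 h2]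
      exact hℓ.1 r (by tauto)
    · rw [(relabel_chord hp hq ℓ _ _ hc).1, (relabel_chord hp hq ℓ _ _ hc).2, hℓ.2.2 c hc]
  · rintro ⟨ℓ, t⟩ hℓ
    simp only [Finset.mem_product, mem_labellings, Finset.mem_univ, and_true,
      Finset.mem_erase] at hℓ
    simp only [mem_labellings, Finset.mem_insert, forall_eq_or_imp]
    refine ⟨fun r hr => ?_, ?_, fun c hc => ?_⟩
    · rw [relabel_of_ne _ (ne_of_mem_of_not_mem hpP hr).symm
      (ne_of_mem_of_not_mem hqP hr).symm]
      exact hℓ.1 r (by tauto)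
    · rw [relabel_left _ hpq, relabel_right]
    · rw [(relabel_chord hp hq ℓ _ _ hc).1, (relabel_chord hp hq ℓ _ _ hc).2, hℓ.2 c hc]
  · intro ℓ hℓ
    simp only [mem_labellings, Finset.mem_insert, forall_eq_or_imp] at hℓ
    simp only [relabel_relabel]
    exact relabel_self _ rfl hℓ.2.1
  · rintro ⟨ℓ, t⟩ hℓ
    simp only [Finset.mem_product, mem_labellings, Finset.mem_univ, and_true,
      Finset.mem_erase] at hℓ
    simp only [relabel_relabel, relabel_left _ hpq, Prod.mk.injEq, and_true]
    exact relabel_self _ (hℓ.1 p (by tauto)).symm (hℓ.1 q (by tauto)).symm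
  · intro ℓ hℓ
    simp only [mem_labellings, Finset.mem_insert, forall_eq_or_imp] at hℓ
    simp only [relabel_relabel]
    rw [relabel_self _ rfl hℓ.2.1]

section Reconnect

variable {A : Type*} [Ring A]

/-- The sum over the labellings of the words read along `P`. -/
noncomputable def wordSum (S : Fin 3 → A) (P : Finset ℕ) (D : Finset Chord) : A :=
  ∑ ℓ ∈ labellings P D, word (S ∘ ℓ) P.sort

/-- If `p` and `q` carry equal labels, so do all four ends; giving `p` and `q` a new common label
makes `(p, q)` and `(p', q')` the chords. The old label survives at `p'`, which inverts the map.
Exchanging the labels of `p` and `q` makes `(p, q')` and `(q, p')` the chords. -/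
theorem sum_labellings_pairTerm_of_ne (S : Fin 3 → A) (l : List ℕ) {P : Finset ℕ}
    {R : Finset Chord} {p p' q q' : ℕ} (hpp : p ≠ p') (hpq : p ≠ q) (hpq' : p ≠ q')
    (hp'q : p' ≠ q) (hqq : q ≠ q') (hpP : p ∈ P) (hqP : q ∈ P)
    (hp : p ∉ chordEnds R) (hq : q ∉ chordEnds R) :
    ∑ ℓ ∈ labellings P (insert (p, p') (insert (q, q') R)), pairTerm S l ℓ p q =
      ∑ ℓ ∈ labellings P (insert (p, q) (insert (p', q') R)), word (S ∘ ℓ) l -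
        ∑ ℓ ∈ labellings P (insert (p, q') (insert (q, p') R)), word (S ∘ ℓ) l := by
  simp only [pairTerm]
  rw [Finset.sum_sub_distrib]
  have off : ∀ (ℓ : ℕ → Fin 3) s t, (∀ r, r ∉ P → ℓ r = 0) →
      ∀ r, r ∉ P → relabel ℓ p q s t r = 0 := fun ℓ s t h r hr => by
    rw [relabel_of_ne _ (ne_of_mem_of_not_mem hpP hr).symm
      (ne_of_mem_of_not_mem hqP hr).symm, h r hr]
  have p'e : ∀ (ℓ : ℕ → Fin 3) s t, relabel ℓ p q s t p' = ℓ p' := fun ℓ s t =>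
    relabel_of_ne _ hpp.symm hp'q _ _
  have q'e : ∀ (ℓ : ℕ → Fin 3) s t, relabel ℓ p q s t q' = ℓ q' := fun ℓ s t =>
    relabel_of_ne _ hpq'.symm hqq.symm _ _
  congr 1
  · rw [← Finset.sum_filter, ← Finset.sum_product']
    refine Finset.sum_nbij' (fun x => relabel x.1 p q x.2 x.2)
      (fun ℓ => (relabel ℓ p q (ℓ p') (ℓ p'), ℓ p)) ?_ ?_ ?_ ?_ ?_
    · rintro ⟨ℓ, t⟩ hℓ
      simp only [Finset.mem_product, Finset.mem_filter, mem_labellings, Finset.mem_univ, and_true,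
        Finset.mem_insert, forall_eq_or_imp] at hℓ
      obtain ⟨⟨h0, h1, h2, h3⟩, h4⟩ := hℓ
      simp only [mem_labellings, Finset.mem_insert, forall_eq_or_imp, relabel_left _ hpq,
        relabel_right, p'e, q'e]
      refine ⟨off _ _ _ h0, trivial, by rw [← h1, h4, h2], fun c hc => ?_⟩
      rw [(relabel_chord hp hq ℓ _ _ hc).1, (relabel_chord hp hq ℓ _ _ hc).2, h3 c hc]
    · intro ℓ hℓ
      simp only [mem_labellings, Finset.mem_insert, forall_eq_or_imp] at hℓ
      obtain ⟨h0, h1, h2, h3⟩ := hℓ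
      simp only [Finset.mem_product, Finset.mem_filter, mem_labellings, Finset.mem_univ, and_true,
        Finset.mem_insert, forall_eq_or_imp, relabel_left _ hpq,
        relabel_right, p'e, q'e, true_and]
      refine ⟨off _ _ _ h0, h2, fun c hc => ?_⟩
      rw [(relabel_chord hp hq ℓ _ _ hc).1, (relabel_chord hp hq ℓ _ _ hc).2, h3 c hc]
    · rintro ⟨ℓ, t⟩ hℓ
      simp only [Finset.mem_product, Finset.mem_filter, mem_labellings, Finset.mem_univ, and_true,
        Finset.mem_insert, forall_eq_or_imp] at hℓ
      obtain ⟨⟨h0, h1, h2, h3⟩, h4⟩ := hℓ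
      simp only [relabel_relabel, relabel_left _ hpq, p'e, Prod.mk.injEq, and_true]
      exact relabel_self _ h1.symm (by rw [← h1, h4])
    · intro ℓ hℓ
      simp only [mem_labellings, Finset.mem_insert, forall_eq_or_imp] at hℓ
      obtain ⟨h0, h1, h2, h3⟩ := hℓ
      simp only [relabel_relabel]
      exact relabel_self _ rfl h1
    · intros; rfl
  · refine Finset.sum_nbij' (fun ℓ => relabel ℓ p q (ℓ q) (ℓ p))
      (fun ℓ => relabel ℓ p q (ℓ q) (ℓ p)) ?_ ?_ ?_ ?_ ?_
    · intro ℓ hℓ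
      simp only [mem_labellings, Finset.mem_insert, forall_eq_or_imp] at hℓ
      obtain ⟨h0, h1, h2, h3⟩ := hℓ
      simp only [mem_labellings, Finset.mem_insert, forall_eq_or_imp, relabel_left _ hpq,
        relabel_right, p'e, q'e]
      refine ⟨off _ _ _ h0, h2, h1, fun c hc => ?_⟩
      rw [(relabel_chord hp hq ℓ _ _ hc).1, (relabel_chord hp hq ℓ _ _ hc).2, h3 c hc]
    · intro ℓ hℓ
      simp only [mem_labellings, Finset.mem_insert, forall_eq_or_imp] at hℓ
      obtain ⟨h0, h1, h2, h3⟩ := hℓ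
      simp only [mem_labellings, Finset.mem_insert, forall_eq_or_imp, relabel_left _ hpq,
        relabel_right, p'e, q'e]
      refine ⟨off _ _ _ h0, h2, h1, fun c hc => ?_⟩
      rw [(relabel_chord hp hq ℓ _ _ hc).1, (relabel_chord hp hq ℓ _ _ hc).2, h3 c hc]
    · intro ℓ _
      simp only [relabel_relabel, relabel_left _ hpq, relabel_right]
      exact relabel_self _ rfl rfl
    · intro ℓ _
      simp only [relabel_relabel, relabel_left _ hpq, relabel_right]
      exact relabel_self _ rfl rfl
    · intros; rfl

theorem sum_labellings_pairTerm_self (S : Fin 3 → A) (l : List ℕ) {P : Finset ℕ}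
    {R : Finset Chord} {p q : ℕ} (hpq : p ≠ q) (hpP : p ∈ P) (hqP : q ∈ P)
    (hp : p ∉ chordEnds R) (hq : q ∉ chordEnds R) :
    ∑ ℓ ∈ labellings P (insert (p, q) R), pairTerm S l ℓ p q =
      2 * ∑ ℓ ∈ labellings P (insert (p, q) R), word (S ∘ ℓ) l := by
  rw [sum_labellings_insert hpq hpP hqP hp hq, sum_labellings_insert hpq hpP hqP hp hq,
    Finset.mul_sum]
  refine Finset.sum_congr rfl fun ℓ _ => ?_
  simp only [pairTerm, relabel_relabel, relabel_left _ hpq, relabel_right, if_true]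
  -- The equal-label term gives the same sum once for each of the three old labels, and the exchange
  -- term removes one copy: `3 - 1 = 2`.
  rw [Finset.sum_sub_distrib, Finset.sum_const, Finset.card_univ, Fintype.card_fin, two_mul]
  abel

end Reconnect

/-! ### The Chmutov–Varchenko recursion for word sums. -/

theorem sort_union_of_lt {s t : Finset ℕ} (h : ∀ p ∈ s, ∀ q ∈ t, p < q) :
    (s ∪ t).sort = s.sort ++ t.sort := by
  have hd : ∀ p ∈ s.sort, ∀ q ∈ t.sort, p ≠ q := fun p hp q hq =>
    (h p (by simpa using hp) q (by simpa using hq)).ne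
  have hn : (s.sort ++ t.sort).Nodup :=
    List.nodup_append.mpr ⟨s.sort_nodup _, t.sort_nodup _, hd⟩
  have h1 : (s.sort ++ t.sort).toFinset = s ∪ t := by
    rw [List.toFinset_append, Finset.sort_toFinset, Finset.sort_toFinset]
  rw [← h1]
  refine (List.toFinset_sort (· ≤ ·) hn).mpr (List.pairwise_append.mpr
    ⟨s.pairwise_sort _, t.pairwise_sort _, fun p hp q hq => ?_⟩)
  exact (h p (by simpa using hp) q (by simpa using hq)).le

theorem sort_eq_of_arc {P : Finset ℕ} {a : Chord} (ha : a.1 < a.2) (h1 : a.1 ∈ P) (h2 : a.2 ∈ P) :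
    P.sort = (P.filter (· < a.1)).sort ++
      (a.1 :: ((P.filter (OnSide a)).sort ++ (a.2 :: (P.filter (a.2 < ·)).sort))) := by
  have e : P = P.filter (· < a.1) ∪ ({a.1} ∪ (P.filter (OnSide a) ∪
      ({a.2} ∪ P.filter (a.2 < ·)))) := by
    ext p
    simp only [Finset.mem_union, Finset.mem_filter, Finset.mem_singleton, OnSide]
    constructor
    · intro hp
      simp only [hp, true_and]
      omega
    · rintro (h | rfl | h | rfl | h)
      exacts [h.1, h1, h.1, h2, h.1]
  conv_lhs => rw [e]
  rw [sort_union_of_lt, sort_union_of_lt, sort_union_of_lt, sort_union_of_lt,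
    Finset.sort_singleton, Finset.sort_singleton]
  · rfl
  all_goals
    intro p hp q hq
    simp only [Finset.mem_union, Finset.mem_filter, Finset.mem_singleton, OnSide] at hp hq
    omega

theorem sort_erase_eq_of_arc {P : Finset ℕ} {a : Chord} (ha : a.1 < a.2) :
    ((P.erase a.1).erase a.2).sort = (P.filter (· < a.1)).sort ++
      ((P.filter (OnSide a)).sort ++ (P.filter (a.2 < ·)).sort) := by
  have e : (P.erase a.1).erase a.2 = P.filter (· < a.1) ∪ (P.filter (OnSide a) ∪
      P.filter (a.2 < ·)) := by
    ext p
    simp only [Finset.mem_union, Finset.mem_filter, Finset.mem_erase, OnSide]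
    constructor
    · intro hp
      simp only [hp, true_and]
      omega
    · intro h
      have : p ∈ P := by tauto
      simp only [this, true_and, and_true] at h ⊢
      omega
  rw [e, sort_union_of_lt, sort_union_of_lt]
  all_goals
    intro p hp q hq
    simp only [Finset.mem_union, Finset.mem_filter, OnSide] at hp hq
    omega

section Recursion

variable {A : Type*} [Ring A] [Algebra ℂ A] {S : Fin 3 → A} {x : ℂ}

/-- The ends of `a` cut the word into three pieces. The outer two factor out, and the common label
of the ends of `a` conjugates only the middle one. At this stage the scalar counts all points on the
side of `a`, not yet the crossing chords. -/
theorem IsSpinTriple.two_mul_wordSum_insert (hS : IsSpinTriple S x) {P : Finset ℕ}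
    {R : Finset Chord} {a : Chord} (ha : a.1 < a.2) (h1 : a.1 ∈ P) (h2 : a.2 ∈ P)
    (h1R : a.1 ∉ chordEnds R) (h2R : a.2 ∉ chordEnds R) :
    2 * wordSum S P (insert a R) =
      (2 * (x - (P.filter (OnSide a)).card)) • wordSum S ((P.erase a.1).erase a.2) R +
      ∑ p ∈ P.filter (OnSide a), ∑ q ∈ P.filter (OnSide a), if p = q then 0 else
        ∑ ℓ ∈ labellings ((P.erase a.1).erase a.2) R,
          pairTerm S ((P.erase a.1).erase a.2).sort ℓ p q := by
  have hw : ∀ ℓ : ℕ → Fin 3, 2 * ∑ t, word (S ∘ relabel ℓ a.1 a.2 t t) P.sort =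
      (2 * (x - (P.filter (OnSide a)).card)) • word (S ∘ ℓ) ((P.erase a.1).erase a.2).sort +
      ∑ p ∈ P.filter (OnSide a), ∑ q ∈ P.filter (OnSide a), if p = q then 0 else
        pairTerm S ((P.erase a.1).erase a.2).sort ℓ p q := by
    intro ℓ
    have hc : ∀ (t : Fin 3) (l : List ℕ), (∀ p ∈ l, p ≠ a.1 ∧ p ≠ a.2) →
        word (S ∘ relabel ℓ a.1 a.2 t t) l = word (S ∘ ℓ) l := fun t l h =>
      word_congr fun p hp => congrArg S (relabel_of_ne _ (h p hp).1 (h p hp).2 _ _)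
    have e1 : ∀ t, word (S ∘ relabel ℓ a.1 a.2 t t) P.sort =
        word (S ∘ ℓ) (P.filter (· < a.1)).sort *
          (S t * word (S ∘ ℓ) (P.filter (OnSide a)).sort * S t) *
          word (S ∘ ℓ) (P.filter (a.2 < ·)).sort := by
      intro t
      rw [sort_eq_of_arc ha h1 h2, word_append, word_cons, word_append, word_cons, hc, hc, hc]
      · simp only [Function.comp_apply, relabel_left _ ha.ne, relabel_right, mul_assoc]
      all_goals
        intro p hp
        simp only [Finset.mem_sort, Finset.mem_filter, OnSide] at hp
        omega
    have two : ∀ u : A, 2 * u = u * 2 := fun u => by rw [two_mul, mul_two]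
    simp only [e1]
    rw [← Finset.sum_mul, ← Finset.mul_sum, ← mul_assoc, ← mul_assoc,
      two (word _ _),
      mul_assoc (word (S ∘ ℓ) _) 2, hS.two_mul_sum_mul_word_mul (Finset.sort_nodup _ _),
      Finset.sort_toFinset, Finset.length_sort, sort_erase_eq_of_arc ha, word_append, word_append,
      mul_add, add_mul, mul_smul_comm, smul_mul_assoc, mul_assoc, Finset.mul_sum, Finset.sum_mul]
    congr 1
    refine Finset.sum_congr rfl fun p hp => ?_
    rw [Finset.mul_sum, Finset.sum_mul]
    refine Finset.sum_congr rfl fun q hq => ?_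
    simp only [Finset.mem_filter, OnSide] at hp hq
    split_ifs with hpq
    · simp
    · apply pairTerm_append <;> simp only [Finset.mem_sort, Finset.mem_filter] <;> omega
  rw [wordSum, show insert a R = insert (a.1, a.2) R from rfl,
    sum_labellings_insert ha.ne h1 h2 h1R h2R, Finset.mul_sum, Finset.sum_congr rfl fun ℓ _ => hw ℓ,
    Finset.sum_add_distrib, wordSum, Finset.smul_sum]
  congr 1
  rw [Finset.sum_comm]
  refine Finset.sum_congr rfl fun p _ => ?_
  rw [Finset.sum_comm]
  refine Finset.sum_congr rfl fun q _ => ?_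
  split_ifs <;> simp

end Recursion

theorem chordEnds_insert (c : Chord) (D : Finset Chord) :
    chordEnds (insert c D) = insert c.1 (insert c.2 (chordEnds D)) := by
  ext p
  simp only [mem_chordEnds, Finset.mem_insert]
  constructor
  · rintro ⟨d, rfl | hd, h⟩
    · tauto
    · exact .inr (.inr ⟨d, hd, h⟩)
  · rintro (h | h | ⟨d, hd, h⟩)
    exacts [⟨c, .inl rfl, .inl h⟩, ⟨c, .inl rfl, .inr h⟩, ⟨d, .inr hd, h⟩]

theorem IsChordDiagram.fst_inj {n : ℕ} {D : Finset Chord} (hD : IsChordDiagram n D) {c d : Chord}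
    (hc : c ∈ D) (hd : d ∈ D) (h : c.1 = d.1) : c = d := by
  by_contra hcd
  exact (hD.disjoint c hc d hd hcd).1 h

theorem IsChordDiagram.notMem_chordEnds_erase {n : ℕ} {D : Finset Chord}
    (hD : IsChordDiagram n D) {c : Chord} (hc : c ∈ D) :
    c.1 ∉ chordEnds (D.erase c) ∧ c.2 ∉ chordEnds (D.erase c) := by
  simp only [mem_chordEnds, Finset.mem_erase]
  constructor
  all_goals
    rintro ⟨d, ⟨hdc, hd⟩, h⟩
    have := hD.disjoint c hc d hd hdc.symm
    omega

theorem IsChordDiagram.sum_chordEnds {n : ℕ} {D : Finset Chord} (hD : IsChordDiagram n D)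
    {M : Type*} [AddCommMonoid M] (f : ℕ → M) :
    ∑ p ∈ chordEnds D, f p = ∑ c ∈ D, (f c.1 + f c.2) := by
  rw [chordEnds, Finset.sum_union, Finset.sum_image, Finset.sum_image, Finset.sum_add_distrib]
  · intro c hc d hd h
    by_contra hcd
    exact (hD.disjoint c hc d hd hcd).2.2.2 h
  · intro c hc d hd h
    exact hD.fst_inj hc hd h
  · rw [Finset.disjoint_left]
    simp only [Finset.mem_image, not_exists, not_and]
    rintro _ ⟨c, hc, rfl⟩ d hd h
    by_cases hcd : d = c
    · subst hcd
      exact (hD.lt d hd).ne h.symm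
    · exact (hD.disjoint d hd c hc hcd).2.2.1 h

theorem apply_mkChord_iff {α : Type*} (ℓ : ℕ → α) (p q : ℕ) :
    ℓ (mkChord p q).1 = ℓ (mkChord p q).2 ↔ ℓ p = ℓ q := by
  rcases le_total p q with h | h
  · simp [mkChord, h]
  · simp [mkChord, h, eq_comm]

theorem insert_mkChord_ends (p q : ℕ) (s : Finset ℕ) :
    insert (mkChord p q).1 (insert (mkChord p q).2 s) = insert p (insert q s) := by
  rcases le_total p q with h | h
  · simp [mkChord, h]
  · simp [mkChord, h, Finset.insert_comm]

section Recursion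

variable {A : Type*} [Ring A]

/-- The difference of the word sums of the two diagrams obtained from `E` by reconnecting the
chords `d` and `e`: first ends to first ends, respectively first ends to second ends. -/
noncomputable def reconnectDiff (S : Fin 3 → A) (E : Finset Chord) (d e : Chord) : A :=
  wordSum S (chordEnds E) (insert (d.1, e.1) (insert (d.2, e.2) ((E.erase d).erase e))) -
    wordSum S (chordEnds E) (insert (d.1, e.2) (insert (e.1, d.2) ((E.erase d).erase e)))

theorem wordSum_congr (S : Fin 3 → A) {P : Finset ℕ} {D E : Finset Chord}
    (h : ∀ ℓ : ℕ → Fin 3, (∀ c ∈ D, ℓ c.1 = ℓ c.2) ↔ ∀ c ∈ E, ℓ c.1 = ℓ c.2) :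
    wordSum S P D = wordSum S P E := by
  rw [wordSum, wordSum, labellings_congr h]

theorem reconnectDiff_comm (S : Fin 3 → A) (E : Finset Chord) (d e : Chord) :
    reconnectDiff S E d e = reconnectDiff S E e d := by
  rw [reconnectDiff, reconnectDiff, Finset.erase_right_comm]
  congr 1 <;> refine wordSum_congr S fun ℓ => ?_ <;>
    simp only [Finset.mem_insert, forall_eq_or_imp, eq_comm (a := ℓ e.1), eq_comm (a := ℓ e.2),
      and_left_comm]

/-- Exchanging the roles of the two ends of one chord interchanges the two reconnections, hence the
sign pattern. -/
theorem IsChordDiagram.sum_pairTerm {n : ℕ} {E : Finset Chord} (hE : IsChordDiagram n E)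
    (S : Fin 3 → A) {d e : Chord} (hd : d ∈ E) (he : e ∈ E) (hde : d ≠ e) :
    (∑ ℓ ∈ labellings (chordEnds E) E, pairTerm S (chordEnds E).sort ℓ d.1 e.1 =
      reconnectDiff S E d e) ∧
    (∑ ℓ ∈ labellings (chordEnds E) E, pairTerm S (chordEnds E).sort ℓ d.1 e.2 =
      - reconnectDiff S E d e) ∧
    (∑ ℓ ∈ labellings (chordEnds E) E, pairTerm S (chordEnds E).sort ℓ d.2 e.1 =
      - reconnectDiff S E d e) ∧
    (∑ ℓ ∈ labellings (chordEnds E) E, pairTerm S (chordEnds E).sort ℓ d.2 e.2 =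
      reconnectDiff S E d e) := by
  set R := (E.erase d).erase e with hR
  have he' : e ∈ E.erase d := Finset.mem_erase.mpr ⟨hde.symm, he⟩
  have hER : E = insert d (insert e R) := by
    rw [hR, Finset.insert_erase he', Finset.insert_erase hd]
  have hdis := hE.disjoint d hd e he hde
  have hdl := (hE.lt d hd).ne
  have hel := (hE.lt e he).ne
  have sub1 : chordEnds R ⊆ chordEnds (E.erase d) := by
    intro p hp
    rw [mem_chordEnds] at hp ⊢
    obtain ⟨c, hc, h⟩ := hp
    exact ⟨c, Finset.mem_of_mem_erase hc, h⟩
  have sub2 : chordEnds R ⊆ chordEnds (E.erase e) := by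
    intro p hp
    rw [mem_chordEnds] at hp ⊢
    obtain ⟨c, hc, h⟩ := hp
    rw [hR, Finset.erase_right_comm] at hc
    exact ⟨c, Finset.mem_of_mem_erase hc, h⟩
  have hd1 : d.1 ∉ chordEnds R := fun h => (hE.notMem_chordEnds_erase hd).1 (sub1 h)
  have hd2 : d.2 ∉ chordEnds R := fun h => (hE.notMem_chordEnds_erase hd).2 (sub1 h)
  have he1 : e.1 ∉ chordEnds R := fun h => (hE.notMem_chordEnds_erase he).1 (sub2 h)
  have he2 : e.2 ∉ chordEnds R := fun h => (hE.notMem_chordEnds_erase he).2 (sub2 h)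
  have hd1P := fst_mem_chordEnds hd
  have hd2P := snd_mem_chordEnds hd
  have he1P := fst_mem_chordEnds he
  have he2P := snd_mem_chordEnds he
  have lab : ∀ p p' q q', (∀ ℓ : ℕ → Fin 3, (ℓ p = ℓ p' ∧ ℓ q = ℓ q') ↔
      (ℓ d.1 = ℓ d.2 ∧ ℓ e.1 = ℓ e.2)) →
      labellings (chordEnds E) E = labellings (chordEnds E) (insert (p, p') (insert (q, q') R)) := by
    intro p p' q q' h
    refine labellings_congr fun ℓ => ?_
    conv_lhs => rw [hER]
    simp only [Finset.mem_insert, forall_eq_or_imp, ← and_assoc, h]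
  refine ⟨?_, ?_, ?_, ?_⟩
  · rw [lab d.1 d.2 e.1 e.2 fun ℓ => Iff.rfl, sum_labellings_pairTerm_of_ne S _ hdl hdis.1 hdis.2.1
      hdis.2.2.1 hel hd1P he1P hd1 he1]
    rfl
  · rw [lab d.1 d.2 e.2 e.1 fun ℓ => by rw [eq_comm (a := ℓ e.2)],
      sum_labellings_pairTerm_of_ne S _ hdl hdis.2.1 hdis.1
      hdis.2.2.2 hel.symm hd1P he2P hd1 he2, reconnectDiff, neg_sub]
    congr 1 <;> refine wordSum_congr S fun ℓ => ?_ <;>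
      simp only [Finset.mem_insert, forall_eq_or_imp, ← hR, eq_comm (a := ℓ d.2)]
  · rw [lab d.2 d.1 e.1 e.2 fun ℓ => by rw [eq_comm (a := ℓ d.2)],
      sum_labellings_pairTerm_of_ne S _ hdl.symm hdis.2.2.1 hdis.2.2.2
      hdis.1 hel hd2P he1P hd2 he1, reconnectDiff, neg_sub]
    congr 1 <;> refine wordSum_congr S fun ℓ => ?_ <;>
      simp only [Finset.mem_insert, forall_eq_or_imp, ← hR, eq_comm (b := ℓ d.1),
        eq_comm (a := ℓ d.2)] <;> tauto
  · rw [lab d.2 d.1 e.2 e.1 fun ℓ => by rw [eq_comm (a := ℓ d.2), eq_comm (a := ℓ e.2)],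
      sum_labellings_pairTerm_of_ne S _ hdl.symm hdis.2.2.2 hdis.2.2.1
      hdis.2.1 hel.symm hd2P he2P hd2 he2, reconnectDiff]
    congr 1 <;> refine wordSum_congr S fun ℓ => ?_ <;>
      simp only [Finset.mem_insert, forall_eq_or_imp, ← hR, eq_comm (b := ℓ d.1),
        eq_comm (a := ℓ d.2)] <;> tauto

theorem IsChordDiagram.sum_pairTerm_self {n : ℕ} {E : Finset Chord} (hE : IsChordDiagram n E)
    (S : Fin 3 → A) {d : Chord} (hd : d ∈ E) :
    (∑ ℓ ∈ labellings (chordEnds E) E, pairTerm S (chordEnds E).sort ℓ d.1 d.2 =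
      2 * wordSum S (chordEnds E) E) ∧
    (∑ ℓ ∈ labellings (chordEnds E) E, pairTerm S (chordEnds E).sort ℓ d.2 d.1 =
      2 * wordSum S (chordEnds E) E) := by
  have hdl := (hE.lt d hd).ne
  have h1 : ∑ ℓ ∈ labellings (chordEnds E) E, pairTerm S (chordEnds E).sort ℓ d.1 d.2 =
      2 * wordSum S (chordEnds E) E := by
    have := sum_labellings_pairTerm_self S (chordEnds E).sort hdl (fst_mem_chordEnds hd)
      (snd_mem_chordEnds hd) (hE.notMem_chordEnds_erase hd).1 (hE.notMem_chordEnds_erase hd).2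
    rwa [Prod.mk.eta, Finset.insert_erase hd] at this
  refine ⟨h1, ?_⟩
  rw [← h1]
  exact Finset.sum_congr rfl fun ℓ _ => pairTerm_comm _ _ _ hdl.symm

theorem IsChordDiagram.chordEnds_erase {n : ℕ} {D : Finset Chord} (hD : IsChordDiagram n D)
    {a : Chord} (ha : a ∈ D) : chordEnds (D.erase a) = ((chordEnds D).erase a.1).erase a.2 := by
  obtain ⟨h1, h2⟩ := hD.notMem_chordEnds_erase ha
  conv_rhs => rw [← Finset.insert_erase ha, chordEnds_insert]
  ext p
  simp only [Finset.mem_erase, Finset.mem_insert]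
  constructor
  · intro hp
    exact ⟨ne_of_mem_of_not_mem hp h2, ne_of_mem_of_not_mem hp h1, .inr (.inr hp)⟩
  · tauto

theorem chordEnds_resolve {D : Finset Chord} {a d e : Chord} (hd : d ∈ D.erase a)
    (he : e ∈ (D.erase a).erase d) :
    chordEnds (resolveOne D a d e) = chordEnds (D.erase a) ∧
      chordEnds (resolveTwo D a d e) = chordEnds (D.erase a) := by
  have h : chordEnds (D.erase a) = insert d.1 (insert d.2 (insert e.1 (insert e.2
      (chordEnds (((D.erase a).erase d).erase e))))) := by
    rw [← chordEnds_insert, ← chordEnds_insert, Finset.insert_erase he, Finset.insert_erase hd]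
  have hs : ∀ c : Chord, (sideEnd a c = c.1 ∧ farEnd a c = c.2) ∨
      (sideEnd a c = c.2 ∧ farEnd a c = c.1) := by
    intro c
    by_cases h : OnSide a c.1 <;> simp [sideEnd, farEnd, h]
  rw [h]
  constructor
  all_goals
    ext p
    simp only [resolveOne, resolveTwo, chordEnds_insert, insert_mkChord_ends, Finset.mem_insert]
    generalize (p ∈ chordEnds (((D.erase a).erase d).erase e)) = Q
    have hd' := hs d
    have he' := hs e
    clear hs h hd he
    rcases hd' with ⟨e1, e2⟩ | ⟨e1, e2⟩ <;> rcases he' with ⟨e3, e4⟩ | ⟨e3, e4⟩ <;>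
      rw [e1, e2, e3, e4] <;> clear e1 e2 e3 e4 <;> tauto

end Recursion

theorem sum_sum_ite_ne_eq_two_mul {A : Type*} [Ring A] {n : ℕ} {E : Finset Chord} (hE : IsChordDiagram n E)
    (f : Chord → Chord → A) (hf : ∀ d e, f d e = f e d) :
    (∑ d ∈ E, ∑ e ∈ E, if d = e then 0 else f d e) =
      2 * ∑ d ∈ E, ∑ e ∈ E, if d.1 < e.1 then f d e else 0 := by
  have h : ∀ d ∈ E, ∀ e ∈ E, (if d = e then 0 else f d e) =
      (if d.1 < e.1 then f d e else 0) + (if e.1 < d.1 then f e d else 0) := by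
    intro d hd e he
    by_cases hde : d = e
    · subst hde; simp
    · have := (hE.disjoint d hd e he hde).1
      rcases lt_or_gt_of_ne this with h | h
      · simp [hde, h, h.not_gt]
      · simp [hde, h, h.not_gt, hf d e]
  rw [Finset.sum_congr rfl fun d hd => Finset.sum_congr rfl (h d hd)]
  simp only [Finset.sum_add_distrib]
  rw [two_mul]
  congr 1
  exact Finset.sum_comm

section Recursion

variable {A : Type*} [Ring A] [Algebra ℂ A] {S : Fin 3 → A} {x : ℂ}

/-- The indicator of the arc from the first to the second endpoint of `a`. -/
def sideIndicator (a : Chord) (p : ℕ) : ℂ := if OnSide a p then 1 else 0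

/-- The sign that records on which side of `a` the chord `d` begins, and `0` if `d` does not
cross `a`. -/
def sideSign (a d : Chord) : ℂ := sideIndicator a d.1 - sideIndicator a d.2

theorem crosses_iff_onSide {a d : Chord} (ha : a.1 < a.2) (hd : d.1 < d.2)
    (h : a.1 ≠ d.1 ∧ a.1 ≠ d.2 ∧ a.2 ≠ d.1 ∧ a.2 ≠ d.2) :
    Crosses a d ↔ ¬ (OnSide a d.1 ↔ OnSide a d.2) := by
  simp only [Crosses, OnSide]
  omega

theorem sideSign_eq_zero {a d : Chord} (h : OnSide a d.1 ↔ OnSide a d.2) : sideSign a d = 0 := by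
  simp [sideSign, sideIndicator, h]

theorem sideIndicator_crosses {a d : Chord} (h : Crosses a d ↔ ¬ (OnSide a d.1 ↔ OnSide a d.2)) :
    (if Crosses a d then (1 : ℂ) else 0) = sideIndicator a d.1 + sideIndicator a d.2 -
      2 * (sideIndicator a d.1 * sideIndicator a d.2) := by
  simp only [h, sideIndicator]
  by_cases h1 : OnSide a d.1 <;> by_cases h2 : OnSide a d.2 <;> simp [h1, h2]
  norm_num

theorem sideSign_smul_reconnectDiff {D : Finset Chord} {a d e : Chord}
    (hd : ¬ (OnSide a d.1 ↔ OnSide a d.2)) (he : ¬ (OnSide a e.1 ↔ OnSide a e.2)) :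
    (sideSign a d * sideSign a e) • reconnectDiff S (D.erase a) d e =
      wordSum S (chordEnds (D.erase a)) (resolveOne D a d e) -
        wordSum S (chordEnds (D.erase a)) (resolveTwo D a d e) := by
  simp only [sideSign, sideIndicator, reconnectDiff]
  by_cases d1 : OnSide a d.1 <;> by_cases d2 : OnSide a d.2 <;>
    by_cases e1 : OnSide a e.1 <;> by_cases e2 : OnSide a e.2 <;>
    simp only [d1, d2, e1, e2, not_true_eq_false, not_false_eq_true, iff_true, iff_false,
      if_true, if_false] at hd he ⊢
  · norm_num
    congr 1 <;> refine wordSum_congr S fun ℓ => ?_ <;>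
      simp only [resolveOne, resolveTwo, sideEnd, farEnd, d1, e1, if_true, Finset.mem_insert,
        forall_eq_or_imp, apply_mkChord_iff]
  · norm_num
    congr 1 <;> refine wordSum_congr S fun ℓ => ?_ <;>
      simp only [resolveOne, resolveTwo, sideEnd, farEnd, d1, e1, if_true, if_false,
        Finset.mem_insert, forall_eq_or_imp, apply_mkChord_iff, eq_comm (a := ℓ d.2)]
  · norm_num
    congr 1 <;> refine wordSum_congr S fun ℓ => ?_ <;>
      simp only [resolveOne, resolveTwo, sideEnd, farEnd, d1, e1, if_true, if_false,
        Finset.mem_insert, forall_eq_or_imp, apply_mkChord_iff, eq_comm (b := ℓ d.1),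
        eq_comm (a := ℓ d.2)] <;> tauto
  · norm_num
    congr 1 <;> refine wordSum_congr S fun ℓ => ?_ <;>
      simp only [resolveOne, resolveTwo, sideEnd, farEnd, d1, e1, if_false,
        Finset.mem_insert, forall_eq_or_imp, apply_mkChord_iff, eq_comm (b := ℓ d.1),
        eq_comm (a := ℓ d.2)] <;> tauto

/-- The point pairs are grouped by chords. A chord with both ends on the side contributes two
ordered pairs worth two copies each, hence the `4`. For two distinct chords the four signs factor as
a product of two `sideSign`s, so a chord that does not cross `a` cancels out. -/
theorem IsChordDiagram.sum_onSide_pairTerm {n : ℕ} {E : Finset Chord} (hE : IsChordDiagram n E)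
    (S : Fin 3 → A) (a : Chord) :
    (∑ p ∈ (chordEnds E).filter (OnSide a), ∑ q ∈ (chordEnds E).filter (OnSide a),
      if p = q then 0 else
        ∑ ℓ ∈ labellings (chordEnds E) E, pairTerm S (chordEnds E).sort ℓ p q) =
      (∑ d ∈ E, 4 * (sideIndicator a d.1 * sideIndicator a d.2)) • wordSum S (chordEnds E) E +
      ∑ d ∈ E, ∑ e ∈ E, if d = e then 0 else
        (sideSign a d * sideSign a e) • reconnectDiff S E d e := by
  set T : ℕ → ℕ → A := fun p q => if p = q then 0 else
    ∑ ℓ ∈ labellings (chordEnds E) E, pairTerm S (chordEnds E).sort ℓ p q with hT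
  have hf : ∀ f : ℕ → A, ∑ p ∈ (chordEnds E).filter (OnSide a), f p =
      ∑ d ∈ E, (sideIndicator a d.1 • f d.1 + sideIndicator a d.2 • f d.2) := by
    intro f
    rw [Finset.sum_filter, hE.sum_chordEnds]
    simp only [sideIndicator, ite_smul, one_smul, zero_smul]
  change ∑ p ∈ (chordEnds E).filter (OnSide a), ∑ q ∈ (chordEnds E).filter (OnSide a), T p q = _
  simp only [hf, Finset.sum_smul]
  rw [← Finset.sum_add_distrib]
  refine Finset.sum_congr rfl fun d hd => ?_
  rw [Finset.smul_sum, Finset.smul_sum, ← Finset.sum_add_distrib]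
  have hone : (4 * (sideIndicator a d.1 * sideIndicator a d.2)) • wordSum S (chordEnds E) E =
      ∑ e ∈ E, if d = e then
        (4 * (sideIndicator a d.1 * sideIndicator a d.2)) • wordSum S (chordEnds E) E else 0 := by
    rw [Finset.sum_ite_eq, if_pos hd]
  rw [hone, ← Finset.sum_add_distrib]
  refine Finset.sum_congr rfl fun e he => ?_
  by_cases hde : d = e
  · subst hde
    have hdl := (hE.lt d hd).ne
    simp only [hT, if_true, hdl, hdl.symm, if_false, (hE.sum_pairTerm_self S hd).1,
      (hE.sum_pairTerm_self S hd).2]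
    rw [two_mul]
    module
  · obtain ⟨h1, h2, h3, h4⟩ := hE.disjoint d hd e he hde
    obtain ⟨t1, t2, t3, t4⟩ := hE.sum_pairTerm S hd he hde
    simp only [hT, hde, h1, h2, h3, h4, if_false, t1, t2, t3, t4, sideSign]
    module

/-- The Chmutov–Varchenko recursion for the word sums of a spin triple. -/
theorem IsSpinTriple.wordSum_recursion (hS : IsSpinTriple S x) {n : ℕ} {D : Finset Chord}
    (hD : IsChordDiagram (n + 1) D) {a : Chord} (ha : a ∈ D) :
    wordSum S (chordEnds D) D =
      (x - (crossing D a).card) • wordSum S (chordEnds (D.erase a)) (D.erase a) +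
      ∑ q ∈ crossingPairs D a,
        (wordSum S (chordEnds (resolveOne D a q.1 q.2)) (resolveOne D a q.1 q.2) -
          wordSum S (chordEnds (resolveTwo D a q.1 q.2)) (resolveTwo D a q.1 q.2)) := by
  have hE := hD.erase ha
  have hal := hD.lt a ha
  obtain ⟨n1, n2⟩ := hD.notMem_chordEnds_erase ha
  have key := hS.two_mul_wordSum_insert hal (fst_mem_chordEnds ha) (snd_mem_chordEnds ha) n1 n2
  rw [Finset.insert_erase ha, ← hD.chordEnds_erase ha] at key
  have hfil : (chordEnds D).filter (OnSide a) = (chordEnds (D.erase a)).filter (OnSide a) := by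
    rw [hD.chordEnds_erase ha]
    ext p
    simp only [Finset.mem_filter, Finset.mem_erase, OnSide]
    constructor
    · rintro ⟨hp, h⟩
      exact ⟨⟨by omega, by omega, hp⟩, h⟩
    · tauto
  set E := D.erase a with hEdef
  have hcr : ∀ d ∈ E, Crosses a d ↔ ¬ (OnSide a d.1 ↔ OnSide a d.2) := fun d hd =>
    crosses_iff_onSide hal (hE.lt d hd) (hD.disjoint a ha d (Finset.mem_of_mem_erase hd)
      (Finset.ne_of_mem_erase hd).symm)
  have hcross : crossing D a = E.filter (Crosses a) := by
    ext d
    simp only [crossing, Finset.mem_filter, hEdef, Finset.mem_erase]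
    constructor
    · rintro ⟨hd, h⟩
      refine ⟨⟨?_, hd⟩, h⟩
      rintro rfl
      simp only [Crosses] at h
      omega
    · tauto
  have hcard : (((chordEnds E).filter (OnSide a)).card : ℂ) =
      ∑ d ∈ E, (sideIndicator a d.1 + sideIndicator a d.2) := by
    rw [Finset.card_filter, Nat.cast_sum, hE.sum_chordEnds]
    simp [sideIndicator]
  -- The points on the side number one per crossing chord and two per chord lying wholly inside. The
  -- `4` per inside chord found above cancels exactly the surplus `2 * 2`, leaving `2 (x - k)`.
  have hk : ((crossing D a).card : ℂ) = ∑ d ∈ E, (sideIndicator a d.1 + sideIndicator a d.2) -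
      2 * ∑ d ∈ E, sideIndicator a d.1 * sideIndicator a d.2 := by
    rw [hcross, Finset.card_filter, Nat.cast_sum, Finset.mul_sum, ← Finset.sum_sub_distrib]
    refine Finset.sum_congr rfl fun d hd => ?_
    rw [← sideIndicator_crosses (hcr d hd)]
    simp
  have hpairs : ∑ q ∈ crossingPairs D a,
        (wordSum S (chordEnds (resolveOne D a q.1 q.2)) (resolveOne D a q.1 q.2) -
          wordSum S (chordEnds (resolveTwo D a q.1 q.2)) (resolveTwo D a q.1 q.2)) =
      ∑ d ∈ E, ∑ e ∈ E, if d.1 < e.1 then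
        (sideSign a d * sideSign a e) • reconnectDiff S E d e else 0 := by
    rw [crossingPairs, Finset.sum_filter, Finset.sum_product, hcross, Finset.sum_filter]
    refine Finset.sum_congr rfl fun d hd => ?_
    by_cases hda : Crosses a d
    · rw [if_pos hda, Finset.sum_filter]
      refine Finset.sum_congr rfl fun e he => ?_
      by_cases hea : Crosses a e
      · rw [if_pos hea]
        dsimp only
        split_ifs with hlt
        · have hed : e ∈ E.erase d := Finset.mem_erase.mpr ⟨fun h => by simp [h] at hlt, he⟩
          rw [(chordEnds_resolve hd hed).1, (chordEnds_resolve hd hed).2,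
            sideSign_smul_reconnectDiff ((hcr d hd).mp hda) ((hcr e he).mp hea)]
        · rfl
      · have := sideSign_eq_zero (not_not.mp ((hcr e he).not.mp hea))
        simp [hea, this]
    · have := sideSign_eq_zero (not_not.mp ((hcr d hd).not.mp hda))
      simp [hda, this]
  rw [hfil, hE.sum_onSide_pairTerm S a, sum_sum_ite_ne_eq_two_mul hE _ fun d e => by
    rw [reconnectDiff_comm, mul_comm], ← hpairs, hcard, ← Finset.mul_sum] at key
  have two : ∀ u v : A, 2 * u = 2 * v → u = v := by
    intro u v h
    have h2 : ∀ w : A, (2 : ℂ) • w = 2 * w := fun w => by rw [two_mul, two_smul]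
    rw [← h2, ← h2] at h
    exact smul_right_injective A (two_ne_zero (α := ℂ)) h
  apply two
  rw [key, hk]
  simp only [two_mul (_ : A)]
  module

/-- The weight of a chord diagram, for any choice of chords, evaluated at the Casimir scalar. -/
theorem IsSpinTriple.wordSum_eq_weight (hS : IsSpinTriple S x) {c : Finset Chord → Chord}
    (hc : IsChordChoice c) {n : ℕ} {D : Finset Chord} (hD : IsChordDiagram n D) :
    wordSum S (chordEnds D) D = (aeval x (weight c n D)) • (1 : A) := by
  induction n generalizing D with
  | zero =>
    have : D = ∅ := Finset.card_eq_zero.mp hD.card_eq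
    subst this
    -- The default label `0` off the point set leaves exactly one labelling, whose word is empty.
    have h : labellings (chordEnds ∅) ∅ = {fun _ => 0} := by
      ext ℓ
      simp [mem_labellings, mem_chordEnds, funext_iff]
    rw [wordSum, h, Finset.sum_singleton]
    simp [weight, chordEnds]
  | succ n ih =>
    have ha := hc n D hD
    rw [hS.wordSum_recursion hD ha, weight, ih (hD.erase ha)]
    have h : ∀ q ∈ crossingPairs D (c D),
        (wordSum S (chordEnds (resolveOne D (c D) q.1 q.2)) (resolveOne D (c D) q.1 q.2) -
          wordSum S (chordEnds (resolveTwo D (c D) q.1 q.2)) (resolveTwo D (c D) q.1 q.2)) =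
        (aeval x (weight c n (resolveOne D (c D) q.1 q.2) -
          weight c n (resolveTwo D (c D) q.1 q.2))) • (1 : A) := by
      intro q hq
      obtain ⟨h1, h2⟩ := isChordDiagram_resolve hD ha hq
      rw [ih h1, ih h2, map_sub, sub_smul]
    rw [Finset.sum_congr rfl h, map_add, map_sum, add_smul, Finset.sum_smul, smul_smul, map_mul]
    simp

end Recursion

/-! ### The word sum of the complete diagram. -/

section CrossSum

variable {A : Type*} [Ring A]

/-- The sum of `(S (t n) ⋯ S (t 1) B) * (S (t n) ⋯ S (t 1) C)` over all `t`. -/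
def crossSum (S : Fin 3 → A) : ℕ → A → A → A
  | 0, B, C => B * C
  | n + 1, B, C => ∑ t, crossSum S n (S t * B) (S t * C)

/-- The chords `(i, N + i)` for `1 ≤ i ≤ n`. -/
def shiftDiagram (N n : ℕ) : Finset Chord := (Finset.Icc 1 n).image fun i => (i, N + i)

theorem mem_chordEnds_shiftDiagram {N n p : ℕ} :
    p ∈ chordEnds (shiftDiagram N n) ↔ (1 ≤ p ∧ p ≤ n) ∨ (N + 1 ≤ p ∧ p ≤ N + n) := by
  simp only [mem_chordEnds, shiftDiagram, Finset.mem_image, Finset.mem_Icc]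
  constructor
  · rintro ⟨_, ⟨i, hi, rfl⟩, h⟩
    simp only at h
    omega
  · rintro (h | h)
    · exact ⟨_, ⟨p, h, rfl⟩, .inl rfl⟩
    · exact ⟨_, ⟨p - N, by omega, rfl⟩, .inr (by simp only; omega)⟩

/-- The shift `N` stays fixed while `n` varies, so that deleting the last chord leaves a diagram of
the same kind; the tails `B` and `C` absorb its two letters. -/
theorem sum_labellings_shiftDiagram (S : Fin 3 → A) {N n : ℕ} (h : n ≤ N) (B C : A) :
    ∑ ℓ ∈ labellings (chordEnds (shiftDiagram N n)) (shiftDiagram N n),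
      (word (S ∘ ℓ) (Finset.Icc 1 n).sort * B) *
        (word (S ∘ ℓ) (Finset.Icc (N + 1) (N + n)).sort * C) = crossSum S n B C := by
  induction n generalizing B C with
  | zero =>
    have h : labellings (chordEnds (shiftDiagram N 0)) (shiftDiagram N 0) = {fun _ => 0} := by
      ext ℓ
      simp [mem_labellings, mem_chordEnds, funext_iff, shiftDiagram]
    rw [h, Finset.sum_singleton]
    simp [crossSum]
  | succ n ih =>
    have hD : shiftDiagram N (n + 1) = insert (n + 1, N + (n + 1)) (shiftDiagram N n) := by
      rw [shiftDiagram, ← Finset.insert_Icc_right_eq_Icc_add_one (by omega), Finset.image_insert]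
      rfl
    have hP : ((chordEnds (shiftDiagram N (n + 1))).erase (n + 1)).erase (N + (n + 1)) =
        chordEnds (shiftDiagram N n) := by
      ext p
      simp only [Finset.mem_erase, mem_chordEnds_shiftDiagram]
      omega
    have hs : ∀ M, (Finset.Icc (M + 1) (M + (n + 1))).sort =
        (Finset.Icc (M + 1) (M + n)).sort ++ [M + (n + 1)] := by
      intro M
      have e : Finset.Icc (M + 1) (M + (n + 1)) =
          Finset.Icc (M + 1) (M + n) ∪ {M + (n + 1)} := by
        ext p
        simp only [Finset.mem_union, Finset.mem_Icc, Finset.mem_singleton]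
        omega
      rw [e, sort_union_of_lt, Finset.sort_singleton]
      intro p hp q hq
      simp only [Finset.mem_Icc, Finset.mem_singleton] at hp hq
      omega
    have hs0 := hs 0
    simp only [zero_add] at hs0
    have hL := sum_labellings_insert (M := A) (P := chordEnds (shiftDiagram N (n + 1)))
      (R := shiftDiagram N n) (p := n + 1) (q := N + (n + 1)) (by omega)
      (mem_chordEnds_shiftDiagram.mpr (by omega)) (mem_chordEnds_shiftDiagram.mpr (by omega))
      (by rw [mem_chordEnds_shiftDiagram]; omega) (by rw [mem_chordEnds_shiftDiagram]; omega)
    rw [hP, ← hD] at hL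
    rw [hL, Finset.sum_comm, crossSum]
    refine Finset.sum_congr rfl fun t _ => ?_
    rw [← ih (by omega)]
    refine Finset.sum_congr rfl fun ℓ _ => ?_
    have hc : ∀ l : List ℕ, (∀ p ∈ l, p ≠ n + 1 ∧ p ≠ N + (n + 1)) →
        word (S ∘ relabel ℓ (n + 1) (N + (n + 1)) t t) l = word (S ∘ ℓ) l := fun l h =>
      word_congr fun p hp => congrArg S (relabel_of_ne _ (h p hp).1 (h p hp).2 _ _)
    rw [hs0, hs N, word_append, word_append, word_cons, word_cons, word_nil, mul_one,
      mul_one, hc, hc, Function.comp_apply, Function.comp_apply, relabel_left _ (by omega), relabel_right]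
    · simp only [mul_assoc]
    all_goals
      intro p hp
      simp only [Finset.mem_sort, Finset.mem_Icc] at hp
      omega

theorem wordSum_completeDiagram (S : Fin 3 → A) (n : ℕ) :
    wordSum S (chordEnds (completeDiagram n)) (completeDiagram n) = crossSum S n 1 1 := by
  have hD : completeDiagram n = shiftDiagram n n := rfl
  rw [← sum_labellings_shiftDiagram S le_rfl, wordSum, hD]
  have e : chordEnds (shiftDiagram n n) = Finset.Icc 1 n ∪ Finset.Icc (n + 1) (n + n) := by
    ext p
    rw [mem_chordEnds_shiftDiagram, Finset.mem_union, Finset.mem_Icc, Finset.mem_Icc]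
  have hs : (chordEnds (shiftDiagram n n)).sort =
      (Finset.Icc 1 n).sort ++ (Finset.Icc (n + 1) (n + n)).sort := by
    rw [e, sort_union_of_lt]
    intro p hp q hq
    simp only [Finset.mem_Icc] at hp hq
    omega
  refine Finset.sum_congr rfl fun ℓ _ => ?_
  rw [hs, word_append, mul_one, mul_one]

end CrossSum

/-! ### Spin operators of arbitrary complex spin on polynomials. -/

section Model

/-- The raising operator of spin `j` on polynomials with coefficients in `B`. -/
noncomputable def spinRaise (B : Type*) [Ring B] [Algebra ℂ B] (j : ℂ) : B[X] →ₗ[ℂ] B[X] :=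
  (2 * j) • LinearMap.mulLeft ℂ X -
    LinearMap.mulLeft ℂ (X * X) ∘ₗ (derivative (R := B)).restrictScalars ℂ

/-- The lowering operator on polynomials with coefficients in `B`. -/
noncomputable def spinLower (B : Type*) [Ring B] [Algebra ℂ B] : B[X] →ₗ[ℂ] B[X] :=
  (derivative (R := B)).restrictScalars ℂ

/-- The weight operator of spin `j` on polynomials with coefficients in `B`. -/
noncomputable def spinWeight (B : Type*) [Ring B] [Algebra ℂ B] (j : ℂ) : B[X] →ₗ[ℂ] B[X] :=
  LinearMap.mulLeft ℂ X ∘ₗ (derivative (R := B)).restrictScalars ℂ - j • LinearMap.id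

/-- The Cartesian spin operators of spin `j` on polynomials with coefficients in `B`. -/
noncomputable def spinOp (B : Type*) [Ring B] [Algebra ℂ B] (j : ℂ) :
    Fin 3 → Module.End ℂ B[X] :=
  ![(1 / 2 : ℂ) • (spinRaise B j + spinLower B),
    (-(Complex.I / 2)) • (spinRaise B j - spinLower B), spinWeight B j]

variable {B : Type*} [Ring B] [Algebra ℂ B]

theorem spinRaise_apply (j : ℂ) (z : B[X]) :
    spinRaise B j z = (2 * j) • (X * z) - X * X * derivative z := by
  simp [spinRaise, mul_assoc]

theorem spinLower_apply (z : B[X]) : spinLower B z = derivative z := rfl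

theorem spinWeight_apply (j : ℂ) (z : B[X]) :
    spinWeight B j z = X * derivative z - j • z := by
  simp [spinWeight]

/-- The relations are first checked in the ladder basis, where they are identities of differential
operators, and then transferred to the Cartesian one. No integrality of `2 j` is needed, so `j` can
serve as a polynomial variable. -/
theorem isSpinTriple_spinOp (j : ℂ) : IsSpinTriple (spinOp ℂ j) (j * (j + 1)) := by
  set P : Module.End ℂ ℂ[X] := spinRaise ℂ j with hP
  set M : Module.End ℂ ℂ[X] := spinLower ℂ with hM
  set Z : Module.End ℂ ℂ[X] := spinWeight ℂ j with hZ
  have hPM : P * M - M * P = (2 : ℂ) • Z := by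
    refine LinearMap.ext fun f => ?_
    simp only [hP, hM, hZ, LinearMap.sub_apply, Module.End.mul_apply, LinearMap.smul_apply,
      spinRaise_apply, spinLower_apply, spinWeight_apply, smul_eq_C_mul, derivative_mul,
      derivative_sub, derivative_C, derivative_X, C_mul, map_ofNat, derivative_ofNat]
    ring
  have hZM : Z * M - M * Z = -M := by
    refine LinearMap.ext fun f => ?_
    simp only [hM, hZ, LinearMap.sub_apply, Module.End.mul_apply, LinearMap.neg_apply,
      spinLower_apply, spinWeight_apply, smul_eq_C_mul, derivative_mul,
      derivative_sub, derivative_C, derivative_X]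
    ring
  have hZP : Z * P - P * Z = P := by
    refine LinearMap.ext fun f => ?_
    simp only [hP, hZ, LinearMap.sub_apply, Module.End.mul_apply,
      spinRaise_apply, spinWeight_apply, smul_eq_C_mul, derivative_mul,
      derivative_sub, derivative_C, derivative_X, C_mul, map_ofNat, derivative_ofNat]
    ring
  have hcas : (2 : ℂ) • (Z * Z) + (P * M + M * P) =
      (2 * (j * (j + 1))) • (1 : Module.End ℂ ℂ[X]) := by
    refine LinearMap.ext fun f => ?_
    simp only [hP, hM, hZ, LinearMap.add_apply, Module.End.mul_apply,
      LinearMap.smul_apply, Module.End.one_apply,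
      spinRaise_apply, spinLower_apply, spinWeight_apply, smul_eq_C_mul, derivative_mul,
      derivative_sub, derivative_C, derivative_X, C_mul, map_ofNat, derivative_ofNat, C_add,
      C_1]
    ring
  have h0 : spinOp ℂ j 0 = (1 / 2 : ℂ) • (P + M) := rfl
  have h1 : spinOp ℂ j 1 = (-(Complex.I / 2)) • (P - M) := rfl
  have h2 : spinOp ℂ j 2 = Z := rfl
  have hI := Complex.I_mul_I
  constructor
  · rw [h0, h1, h2]
    simp only [smul_mul_assoc, mul_smul_comm, add_mul, mul_add, sub_mul, mul_sub]
    linear_combination (norm := module) (Complex.I / 2) • hPM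
  · rw [h0, h1, h2]
    simp only [smul_mul_assoc, mul_smul_comm, sub_mul, mul_sub]
    linear_combination (norm := module) (Complex.I / 2) • hZP - (Complex.I / 2) • hZM
  · rw [h0, h1, h2, smul_smul,
      show Complex.I * -(Complex.I / 2) = 1 / 2 by linear_combination (-1 / 2) * hI]
    simp only [smul_mul_assoc, mul_smul_comm, add_mul, mul_add]
    linear_combination (norm := module) (1 / 2 : ℂ) • hZP + (1 / 2 : ℂ) • hZM
  · rw [Fin.sum_univ_three, h0, h1, h2]
    simp only [smul_mul_assoc, mul_smul_comm, smul_smul]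
    rw [show -(Complex.I / 2) * -(Complex.I / 2) = -(1 / 4) by linear_combination (1 / 4) * hI]
    simp only [add_mul, mul_add, sub_mul, mul_sub]
    linear_combination (norm := module) (1 / 2 : ℂ) • hcas

theorem spinOp_C_mul_map (j : ℂ) (t : Fin 3) (b : B) (w : ℂ[X]) :
    spinOp B j t (C b * w.map (algebraMap ℂ B)) =
      C b * (spinOp ℂ j t w).map (algebraMap ℂ B) := by
  have hs : ∀ (r : ℂ) (v : ℂ[X]), (r • v).map (algebraMap ℂ B) = r • v.map (algebraMap ℂ B) := by
    intro r v
    ext i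
    simp [Algebra.smul_def]
  have hX : ∀ z : B[X], X * (C b * z) = C b * (X * z) := fun z => by
    rw [← mul_assoc, X_mul_C, mul_assoc]
  have hd : ∀ z : B[X], derivative (C b * z) = C b * derivative z := fun z => by
    rw [derivative_mul, derivative_C, zero_mul, zero_add]
  have hR : spinRaise B j (C b * w.map (algebraMap ℂ B)) =
      C b * (spinRaise ℂ j w).map (algebraMap ℂ B) := by
    simp only [spinRaise_apply, hd, hX, mul_assoc, Polynomial.map_sub, hs, Polynomial.map_mul,
      map_X, mul_sub, mul_smul_comm, derivative_map]
  have hL : spinLower B (C b * w.map (algebraMap ℂ B)) =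
      C b * (spinLower ℂ w).map (algebraMap ℂ B) := by
    simp only [spinLower_apply, hd, derivative_map]
  have hW : spinWeight B j (C b * w.map (algebraMap ℂ B)) =
      C b * (spinWeight ℂ j w).map (algebraMap ℂ B) := by
    simp only [spinWeight_apply, hd, hX, Polynomial.map_sub, hs, Polynomial.map_mul,
      map_X, mul_sub, mul_smul_comm, derivative_map]
  fin_cases t
  · simp [spinOp, hR, hL, hs, mul_add]
  · simp [spinOp, hR, hL, hs, mul_sub]
  · simp [spinOp, hW]

end Model

/-! ### The tensor Casimir and its action on relative vectors. -/

/-- The algebra of the operators on polynomials. -/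
def PolyEnd : Type := Module.End ℂ ℂ[X]

noncomputable instance : Ring PolyEnd := inferInstanceAs (Ring (Module.End ℂ ℂ[X]))

noncomputable instance : Algebra ℂ PolyEnd := inferInstanceAs (Algebra ℂ (Module.End ℂ ℂ[X]))

/-- The action of the operators on polynomials. -/
noncomputable def PolyEnd.act : PolyEnd →ₐ[ℂ] Module.End ℂ ℂ[X] := AlgHom.id ℂ (Module.End ℂ ℂ[X])

theorem PolyEnd.ext {a b : PolyEnd} (h : ∀ f, a.act f = b.act f) : a = b :=
  LinearMap.ext (f := a.act) (g := b.act) h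

/-- The linear map `∑ a i X ^ i ↦ ∑ a i (X ^ i)`. -/
noncomputable def evalAct : PolyEnd[X] →ₗ[ℂ] ℂ[X] :=
  Polynomial.lsum fun i => LinearMap.applyₗ (X ^ i) ∘ₗ PolyEnd.act.toLinearMap

theorem evalAct_monomial (i : ℕ) (a : PolyEnd) : evalAct (monomial i a) = a.act (X ^ i) := by
  simp [evalAct, Polynomial.lsum_apply]

theorem evalAct_C_mul_map (b : PolyEnd) (w : ℂ[X]) :
    evalAct (C b * w.map (algebraMap ℂ PolyEnd)) = b.act w := by
  induction w using Polynomial.induction_on' with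
  | add p q hp hq => rw [Polynomial.map_add, mul_add, map_add, hp, hq, map_add]
  | monomial i a =>
    rw [map_monomial, C_mul_monomial, evalAct_monomial, ← smul_X_eq_monomial, map_smul,
      Algebra.algebraMap_eq_smul_one, mul_smul_comm, mul_one, map_smul, LinearMap.smul_apply]

/-- The Cartesian spin operators of spin `j`. -/
noncomputable def polySpin (j : ℂ) (t : Fin 3) : PolyEnd := spinOp ℂ j t

theorem act_polySpin (j : ℂ) (t : Fin 3) : (polySpin j t).act = spinOp ℂ j t := rfl

theorem isSpinTriple_polySpin (j : ℂ) : IsSpinTriple (polySpin j) (j * (j + 1)) :=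
  ⟨(isSpinTriple_spinOp j).comm01, (isSpinTriple_spinOp j).comm12, (isSpinTriple_spinOp j).comm20,
    (isSpinTriple_spinOp j).casimir⟩

/-- The invariant tensor of a pair of spin operators, as an operator on polynomials whose
coefficients are operators. -/
noncomputable def casimirOp (j : ℂ) : Module.End ℂ PolyEnd[X] :=
  ∑ t, LinearMap.mulLeft ℂ (C (polySpin j t)) ∘ₗ spinOp PolyEnd j t

/-- `PolyEnd[X]` plays the role of operators tensored with polynomials. The letter before `b` acts
on the coefficients and the letter before `c` on the polynomial factor; `evalAct` then composes the
two halves. -/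
theorem act_crossSum (j : ℂ) (n : ℕ) (b c : PolyEnd) (v : ℂ[X]) :
    (crossSum (polySpin j) n b c).act v =
      evalAct ((casimirOp j ^ n) (C b * (c.act v).map (algebraMap ℂ PolyEnd))) := by
  induction n generalizing b c with
  | zero => rw [crossSum, pow_zero, Module.End.one_apply, evalAct_C_mul_map, map_mul]; rfl
  | succ n ih =>
    rw [crossSum, map_sum, LinearMap.sum_apply, pow_succ, Module.End.mul_apply, casimirOp,
      LinearMap.sum_apply, map_sum, map_sum]
    refine Finset.sum_congr rfl fun t _ => ?_
    rw [← casimirOp, ih, LinearMap.comp_apply, spinOp_C_mul_map, LinearMap.mulLeft_apply,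
      ← mul_assoc, ← C_mul, map_mul PolyEnd.act, act_polySpin]
    rfl

/-- Multiplication by the variable. -/
noncomputable def mulX : PolyEnd := (LinearMap.mulLeft ℂ X : Module.End ℂ ℂ[X])

/-- Differentiation. -/
noncomputable def derivX : PolyEnd := (derivative : Module.End ℂ ℂ[X])

theorem act_mulX (f : ℂ[X]) : mulX.act f = X * f := rfl

theorem act_derivX (f : ℂ[X]) : derivX.act f = derivative f := rfl

theorem derivX_mul_mulX : derivX * mulX = mulX * derivX + 1 := by
  refine PolyEnd.ext fun f => ?_
  simp only [map_mul, map_add, map_one, Module.End.mul_apply, LinearMap.add_apply, act_mulX,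
    act_derivX, derivative_mul, derivative_X, Module.End.one_apply]
  ring

/-- The polynomial `u - v`, where `u` is the operator variable and `v` the formal variable. -/
noncomputable def diffX : PolyEnd[X] := C mulX - X

/-- The relative vectors `(u - v) ^ k ∂ ^ k`. -/
noncomputable def relVec (k : ℕ) : PolyEnd[X] := diffX ^ k * C derivX ^ k

theorem derivative_diffX_pow_succ (k : ℕ) :
    derivative (diffX ^ (k + 1)) = -((k : ℂ) + 1) • diffX ^ k := by
  have h1 : derivative diffX = -1 := by simp [diffX]
  induction k with
  | zero => simp [h1]
  | succ k ih =>
    rw [pow_succ, derivative_mul, ih, h1, smul_mul_assoc, ← pow_succ]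
    push_cast
    rw [mul_neg, mul_one]
    module

theorem diffX_mul_derivative (k : ℕ) :
    diffX * derivative (diffX ^ k) = -(k : ℂ) • diffX ^ k := by
  cases k with
  | zero => simp
  | succ k =>
    rw [derivative_diffX_pow_succ, mul_smul_comm, ← pow_succ']
    push_cast
    rfl

theorem diffX_mul_diffX_mul_derivative (k : ℕ) :
    diffX * (diffX * derivative (derivative (diffX ^ k))) =
      ((k : ℂ) * (k - 1)) • diffX ^ k := by
  cases k with
  | zero => simp
  | succ k =>
    have h : derivative (-((k : ℂ) + 1) • diffX ^ k) = -((k : ℂ) + 1) • derivative (diffX ^ k) :=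
      derivative_smul _ _
    rw [derivative_diffX_pow_succ, h, mul_smul_comm, diffX_mul_derivative, smul_smul,
      mul_smul_comm, ← pow_succ']
    push_cast
    congr 1
    ring

/-- On functions of `u - v`, commutation with `∂_u` is minus differentiation in `v`. -/
theorem C_derivX_mul_diffX_pow (k : ℕ) :
    C derivX * diffX ^ k = diffX ^ k * C derivX - derivative (diffX ^ k) := by
  have h : C derivX * diffX = diffX * C derivX + 1 := by
    rw [diffX, mul_sub, sub_mul, ← C_mul, derivX_mul_mulX, C_add, C_mul, C_1, X_mul_C]
    abel
  have hd : derivative diffX = -1 := by simp [diffX]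
  induction k with
  | zero => simp
  | succ k ih =>
    rw [pow_succ, ← mul_assoc, ih, derivative_mul, hd, sub_mul, mul_assoc, h]
    noncomm_ring

theorem C_derivX_mul_derivative (k : ℕ) :
    C derivX * derivative (diffX ^ k) =
      derivative (diffX ^ k) * C derivX - derivative (derivative (diffX ^ k)) := by
  cases k with
  | zero => simp
  | succ k =>
    have h : derivative (-((k : ℂ) + 1) • diffX ^ k) = -((k : ℂ) + 1) • derivative (diffX ^ k) :=
      derivative_smul _ _
    rw [derivative_diffX_pow_succ, h, mul_smul_comm, C_derivX_mul_diffX_pow, smul_mul_assoc,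
      smul_sub]

/-- Here `d` stands for `∂_u`, and `f`, `g` for a vector and its `v`-derivative. In normal order the
variables enter only through `u - v`, which is why powers of `u - v` are the right vectors. The
proof never moves `d` past `u`. -/
theorem casimir_normal_form {R : Type*} [Ring R] [Algebra ℂ R] {u v d : R} (huv : v * u = u * v)
    (hdv : d * v = v * d) (j : ℂ) (f g : R) :
    (u * d - j • 1) * (v * g - j • f) +
      (1 / 2 : ℂ) • (((2 * j) • u - u * u * d) * g + d * ((2 * j) • (v * f) - v * v * g)) =
    (-(1 / 2) : ℂ) • ((u - v) * ((u - v) * (d * g))) - j • ((u - v) * (d * f)) +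
      j • ((u - v) * g) + (j * j) • f := by
  have huv' : ∀ w, v * (u * w) = u * (v * w) := fun w => by rw [← mul_assoc, huv, mul_assoc]
  have hdv' : ∀ w, d * (v * w) = v * (d * w) := fun w => by rw [← mul_assoc, hdv, mul_assoc]
  simp only [mul_sub, sub_mul, smul_mul_assoc, mul_smul_comm, mul_assoc, huv', hdv',
    one_mul]
  module

theorem casimirOp_apply (j : ℂ) (z : PolyEnd[X]) :
    casimirOp j z = (C mulX * C derivX - j • 1) * (X * derivative z - j • z) +
      (1 / 2 : ℂ) • (((2 * j) • C mulX - C mulX * C mulX * C derivX) * derivative z +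
        C derivX * ((2 * j) • (X * z) - X * X * derivative z)) := by
  have h0 : polySpin j 0 = (1 / 2 : ℂ) • ((2 * j) • mulX - mulX * mulX * derivX + derivX) := by
    refine PolyEnd.ext fun f => ?_
    simp only [map_smul, map_add, map_sub, map_mul, LinearMap.smul_apply, LinearMap.add_apply,
      LinearMap.sub_apply, Module.End.mul_apply, act_mulX, act_derivX, ← mul_assoc,
      ← spinRaise_apply]
    rfl
  have h1 : polySpin j 1 =
      (-(Complex.I / 2)) • ((2 * j) • mulX - mulX * mulX * derivX - derivX) := by
    refine PolyEnd.ext fun f => ?_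
    simp only [map_smul, map_sub, map_mul, LinearMap.smul_apply,
      LinearMap.sub_apply, Module.End.mul_apply, act_mulX, act_derivX, ← mul_assoc,
      ← spinRaise_apply]
    rfl
  have h2 : polySpin j 2 = mulX * derivX - j • 1 := by
    refine PolyEnd.ext fun f => ?_
    simp only [map_smul, map_sub, map_mul, map_one, LinearMap.smul_apply, Module.End.one_apply,
      LinearMap.sub_apply, Module.End.mul_apply, act_mulX, act_derivX, ← spinWeight_apply]
    rfl
  have s0 : spinOp PolyEnd j 0 =
      (1 / 2 : ℂ) • (spinRaise PolyEnd j + spinLower PolyEnd) := rfl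
  have s1 : spinOp PolyEnd j 1 =
      (-(Complex.I / 2)) • (spinRaise PolyEnd j - spinLower PolyEnd) := rfl
  have s2 : spinOp PolyEnd j 2 = spinWeight PolyEnd j := rfl
  have hs : ∀ (r : ℂ) (a : PolyEnd), C (r • a) = r • C a := fun r a => (smul_C r a).symm
  rw [casimirOp, LinearMap.sum_apply, Fin.sum_univ_three]
  simp only [LinearMap.comp_apply, LinearMap.mulLeft_apply, h0, h1, h2, s0, s1, s2]
  rw [← spinWeight_apply, ← spinRaise_apply, ← spinLower_apply z]
  simp only [LinearMap.smul_apply, LinearMap.add_apply, LinearMap.sub_apply, hs, smul_mul_assoc,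
    mul_smul_comm, smul_smul, C_mul, C_sub, C_add, C_1]
  rw [show -(Complex.I / 2) * -(Complex.I / 2) = -(1 / 4) by
    linear_combination (1 / 4) * Complex.I_mul_I]
  simp only [add_mul, mul_add, sub_mul, mul_sub, smul_mul_assoc]
  module

/-- In the normal form each factor `u - v` is accompanied by one derivative. A derivative spent on
`(u - v) ^ k` returns the same vector, and a `∂_u` that passes through raises `k` by one. -/
theorem casimirOp_relVec (j : ℂ) (k : ℕ) :
    casimirOp j (relVec k) = ((k : ℂ) / 2 - j) • relVec (k + 1) +
      ((k : ℂ) * (k - 1) / 2 - 2 * j * k + j ^ 2) • relVec k := by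
  have hder : derivative (relVec k) = derivative (diffX ^ k) * C derivX ^ k := by
    rw [relVec, derivative_mul, ← C_pow, derivative_C, mul_zero, add_zero]
  have e1 : diffX * (C derivX * relVec k) = relVec (k + 1) + (k : ℂ) • relVec k := by
    rw [relVec, relVec, ← mul_assoc (C derivX), C_derivX_mul_diffX_pow, sub_mul, mul_sub,
      ← mul_assoc diffX (derivative _), diffX_mul_derivative, pow_succ' diffX, pow_succ' (C derivX)]
    simp only [mul_assoc, smul_mul_assoc]
    module
  have e2 : diffX * derivative (relVec k) = -(k : ℂ) • relVec k := by
    rw [hder, ← mul_assoc, diffX_mul_derivative, smul_mul_assoc, relVec]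
  have e3 : diffX * (diffX * (C derivX * derivative (relVec k))) =
      -(k : ℂ) • relVec (k + 1) - ((k : ℂ) * (k - 1)) • relVec k := by
    have a1 : ∀ w, diffX * (diffX * (derivative (derivative (diffX ^ k)) * w)) =
        ((k : ℂ) * (k - 1)) • (diffX ^ k * w) := fun w => by
      rw [← mul_assoc diffX (derivative _), ← mul_assoc diffX (diffX * _),
        diffX_mul_diffX_mul_derivative, smul_mul_assoc]
    have a2 : ∀ w, diffX * (derivative (diffX ^ k) * w) = -(k : ℂ) • (diffX ^ k * w) := fun w => by
      rw [← mul_assoc diffX (derivative _), diffX_mul_derivative, smul_mul_assoc]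
    rw [hder, ← mul_assoc (C derivX), C_derivX_mul_derivative, sub_mul, mul_sub, mul_sub, a1,
      mul_assoc (derivative _), a2, mul_smul_comm, relVec, relVec, pow_succ' diffX,
      pow_succ' (C derivX), mul_assoc diffX]
  have e4 : C mulX - X = diffX := rfl
  rw [casimirOp_apply, casimir_normal_form (X_mul_C _) (X_mul_C _).symm, e4, e1, e2, e3]
  module

/-- Multiplying the argument of an operator by the variable is right multiplication of the operator.
So after contraction `u - v` acts as the commutator with multiplication by `X`. -/
theorem evalAct_diffX_mul (z : PolyEnd[X]) :
    evalAct (diffX * z) = evalAct (C mulX * z - z * C mulX) := by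
  rw [diffX, sub_mul, map_sub, map_sub]
  congr 1
  induction z using Polynomial.induction_on' with
  | add p q hp hq => rw [mul_add, add_mul, map_add, map_add, hp, hq]
  | monomial i a =>
    rw [X_mul_monomial, monomial_mul_C, evalAct_monomial, evalAct_monomial, pow_succ']
    rfl

/-- One factor `u - v` becomes a commutator, and `[X, ∂ ^ (k + 1)] = -(k + 1) ∂ ^ k`. -/
theorem evalAct_relVec (k : ℕ) : evalAct (relVec k) = ((-1) ^ k * (k.factorial : ℂ)) • 1 := by
  induction k with
  | zero =>
    have : relVec 0 = C 1 * (1 : ℂ[X]).map (algebraMap ℂ PolyEnd) := by simp [relVec]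
    rw [this, evalAct_C_mul_map]
    simp
  | succ k ih =>
    have hcomm : C mulX * diffX ^ k = diffX ^ k * C mulX := by
      have : Commute (C mulX) diffX := by
        refine (Commute.refl _).sub_right ?_
        exact (X_mul_C _).symm
      exact this.pow_right k
    have hpow : ∀ m : ℕ, C derivX ^ m * C mulX =
        C mulX * C derivX ^ m + (m : ℂ) • C derivX ^ (m - 1) := by
      intro m
      induction m with
      | zero => simp
      | succ m ihm =>
        have h1 : C derivX * C mulX = C mulX * C derivX + 1 := by
          rw [← C_mul, derivX_mul_mulX, C_add, C_mul, C_1]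
        have h2 : (m : ℂ) • (C derivX * C derivX ^ (m - 1)) = (m : ℂ) • C derivX ^ m := by
          cases m with
          | zero => simp
          | succ m => rw [Nat.add_sub_cancel, ← pow_succ']
        rw [pow_succ', mul_assoc, ihm, mul_add, ← mul_assoc, h1, mul_smul_comm, h2,
          Nat.add_sub_cancel, add_mul, one_mul, mul_assoc]
        push_cast
        module
    have h : relVec (k + 1) = diffX * (diffX ^ k * C derivX ^ (k + 1)) := by
      rw [relVec, pow_succ', mul_assoc]
    rw [h, evalAct_diffX_mul, ← mul_assoc, hcomm, mul_assoc, mul_assoc, hpow, mul_add,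
      sub_add_cancel_left, mul_smul_comm, map_neg, map_smul, Nat.add_sub_cancel]
    change -(((k + 1 : ℕ) : ℂ) • evalAct (relVec k)) = _
    rw [ih, smul_smul, ← neg_smul, Nat.factorial_succ]
    push_cast
    congr 1
    ring

/-- The polynomials in the spin that give the weights of the complete diagrams. -/
noncomputable def spinMoment : ℕ → ℕ → ℂ[X]
  | 0, _ => 1
  | n + 1, k => (X - C ((k : ℂ) / 2)) * C ((k : ℂ) + 1) * spinMoment n (k + 1) +
      (X ^ 2 - C (2 * (k : ℂ)) * X + C ((k : ℂ) * (k - 1) / 2)) * spinMoment n k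

theorem evalAct_casimirOp_pow (j : ℂ) (n k : ℕ) :
    evalAct ((casimirOp j ^ n) (relVec k)) =
      ((-1) ^ k * (k.factorial : ℂ) * (spinMoment n k).eval j) • 1 := by
  induction n generalizing k with
  | zero => simp [evalAct_relVec, spinMoment]
  | succ n ih =>
    rw [pow_succ, Module.End.mul_apply, casimirOp_relVec, map_add, map_add, map_smul, map_smul,
      map_smul, map_smul, ih, ih, smul_smul, smul_smul, ← add_smul, spinMoment]
    congr 1
    simp only [eval_add, eval_mul, eval_sub, eval_X, eval_C, eval_pow, Nat.factorial_succ]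
    push_cast
    ring

/-- Both sides are polynomials in `j`, so it suffices to compare values at every complex spin; there
the operator is scalar and is read off on the constant polynomial `1`. -/
theorem weight_completeDiagram_comp {c : Finset Chord → Chord} (hc : IsChordChoice c) (n : ℕ) :
    ((weight c n (completeDiagram n)).map (Int.castRingHom ℂ)).comp (X * (X + 1)) =
      spinMoment n 0 := by
  refine Polynomial.funext fun j => ?_
  have h := (isSpinTriple_polySpin j).wordSum_eq_weight hc (isChordDiagram_completeDiagram n)
  rw [wordSum_completeDiagram] at h
  have h1 := act_crossSum j n 1 1 1
  have h2 : C (1 : PolyEnd) * ((1 : PolyEnd).act (1 : ℂ[X])).map (algebraMap ℂ PolyEnd) =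
      relVec 0 := by simp [relVec]
  rw [h, h2, evalAct_casimirOp_pow, map_smul, map_one PolyEnd.act, LinearMap.smul_apply,
    Module.End.one_apply] at h1
  have h3 := congrArg (eval 0) h1
  simp only [eval_smul, eval_one, smul_eq_mul, mul_one, pow_zero, Nat.factorial_zero,
    Nat.cast_one, one_mul] at h3
  rw [← h3, eval_comp, eval_map, aeval_def]
  simp

/-! ### The Genocchi functional and the Seidel triangle. -/

/-- The linear operator `f ↦ f (X) + f (X + 1)`. -/
noncomputable def shiftSum : ℚ[X] →ₗ[ℚ] ℚ[X] := LinearMap.id + taylor 1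

theorem shiftSum_apply (f : ℚ[X]) : shiftSum f = f + f.comp (X + 1) := by
  rw [shiftSum, LinearMap.add_apply, LinearMap.id_apply, taylor_apply, C_1]

theorem degree_sub_taylor_lt {f : ℚ[X]} (hf : f ≠ 0) : (f - taylor 1 f).degree < f.degree :=
  degree_sub_lt_left (degree_taylor f 1).symm hf (leadingCoeff_taylor 1 f).symm

/-- Induction on the degree: `f (X) + f (X + 1)` is `2 f` up to the difference `f (X) - f (X + 1)`,
which has lower degree and is already in the image. -/
theorem shiftSum_surjective : Function.Surjective shiftSum := by
  suffices h : ∀ n : ℕ, ∀ f : ℚ[X], f.degree < n → ∃ g, shiftSum g = f by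
    intro f
    by_cases hf : f = 0
    · exact ⟨0, by rw [map_zero, hf]⟩
    · exact h (f.natDegree + 1) f (by
        rw [degree_eq_natDegree hf]; exact_mod_cast Nat.lt_succ_self _)
  intro n
  induction n with
  | zero =>
    intro f hf
    refine ⟨0, ?_⟩
    rw [map_zero, eq_comm, ← degree_eq_bot]
    exact Nat.WithBot.lt_zero_iff.mp (by exact_mod_cast hf)
  | succ n ih =>
    intro f hf
    by_cases h0 : f = 0
    · exact ⟨0, by rw [map_zero, h0]⟩
    obtain ⟨g, hg⟩ := ih (f - taylor 1 f) (by
      have h1 := degree_sub_taylor_lt h0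
      have h2 : f.degree ≤ n := Order.lt_succ_iff.mp (by exact_mod_cast hf)
      exact h1.trans_le h2)
    refine ⟨(1 / 2 : ℚ) • (f + g), ?_⟩
    rw [map_smul, map_add, hg, shiftSum, LinearMap.add_apply, LinearMap.id_apply]
    module

theorem shiftSum_injective : Function.Injective shiftSum := by
  rw [injective_iff_map_eq_zero]
  intro f hf
  by_contra h0
  rw [shiftSum, LinearMap.add_apply, LinearMap.id_apply] at hf
  have h1 := degree_sub_taylor_lt h0
  have h2 : f - taylor 1 f = C 2 * f := by
    rw [eq_neg_of_add_eq_zero_right hf, map_ofNat]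
    ring
  rw [h2, degree_C_mul two_ne_zero] at h1
  exact lt_irrefl _ h1

/-- The linear functional that sends `f (X) + f (X + 1)` to `f' (0)`; its values on the powers
of `X` are essentially the Genocchi numbers. -/
noncomputable def genocchiFunctional : ℚ[X] →ₗ[ℚ] ℚ :=
  lcoeff ℚ 1 ∘ₗ
    (LinearEquiv.ofBijective shiftSum ⟨shiftSum_injective, shiftSum_surjective⟩).symm.toLinearMap

theorem genocchiFunctional_shiftSum (f : ℚ[X]) : genocchiFunctional (shiftSum f) = f.coeff 1 := by
  have : (LinearEquiv.ofBijective shiftSum ⟨shiftSum_injective, shiftSum_surjective⟩).symm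
      (shiftSum f) = f := LinearEquiv.ofBijective_symm_apply_apply _ _
  simp [genocchiFunctional, this]

/-- If `g = f (X) + f (X + 1)`, the reflection of `g` comes from `f (-X)`. By uniqueness `f` is
even, so `f' (0) = 0`. -/
theorem genocchiFunctional_of_comp_eq {g : ℚ[X]} (hg : g.comp (-1 - X) = g) :
    genocchiFunctional g = 0 := by
  obtain ⟨f, rfl⟩ := shiftSum_surjective g
  have h : f.comp (-X) = f := by
    apply shiftSum_injective
    rw [← hg, shiftSum_apply, shiftSum_apply, add_comp, comp_assoc, comp_assoc, add_comm]
    congr 2 <;> simp <;> ring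
  have h1 : (f.comp (-X)).coeff 1 = - f.coeff 1 := by
    rw [show (-X : ℚ[X]) = C (-1) * X by simp, comp_C_mul_X_coeff]
    ring
  rw [h] at h1
  rw [genocchiFunctional_shiftSum]
  linarith

/-- The values of the Genocchi functional on the products `X ^ i (X + 1) ^ j`. -/
noncomputable def genocchiTable (i j : ℕ) : ℚ := genocchiFunctional (X ^ i * (X + 1) ^ j)

theorem genocchiTable_succ (i j : ℕ) :
    genocchiTable i (j + 1) = genocchiTable (i + 1) j + genocchiTable i j := by
  rw [genocchiTable, genocchiTable, genocchiTable, ← map_add]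
  congr 1
  ring

theorem genocchiTable_self (i : ℕ) : genocchiTable i i = 0 := by
  refine genocchiFunctional_of_comp_eq ?_
  simp only [mul_comp, pow_comp, add_comp, X_comp, one_comp]
  rw [← mul_pow, ← mul_pow]
  congr 1
  ring

/-- Split `(X + 1) ^ N` into half of `(X + 1) ^ N + X ^ N` and half of `(X + 1) ^ N - X ^ N`. The
first gives the linear coefficient of `X ^ N`; the second is reflection-invariant because `N` is
odd. -/
theorem genocchiTable_zero_left {N : ℕ} (hN : Odd N) (h1 : N ≠ 1) : genocchiTable 0 N = 0 := by
  have h : (X : ℚ[X]) ^ 0 * (X + 1) ^ N =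
      (1 / 2 : ℚ) • shiftSum (X ^ N) + (1 / 2 : ℚ) • ((X + 1) ^ N - X ^ N) := by
    rw [shiftSum_apply, pow_comp, X_comp, pow_zero, one_mul]
    module
  have hsymm : ((X + 1) ^ N - X ^ N : ℚ[X]).comp (-1 - X) = (X + 1) ^ N - X ^ N := by
    simp only [sub_comp, pow_comp, add_comp, X_comp, one_comp]
    rw [show (-1 - X + 1 : ℚ[X]) = -X by ring, show (-1 - X : ℚ[X]) = -(X + 1) by ring,
      hN.neg_pow, hN.neg_pow]
    ring
  rw [genocchiTable, h, map_add, map_smul, map_smul, genocchiFunctional_shiftSum,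
    genocchiFunctional_of_comp_eq hsymm, coeff_X_pow, if_neg (Ne.symm h1)]
  simp

/-- The normalized central factorials in which the powers of `X (X + 1)` are expanded. -/
noncomputable def centralFactorial : ℕ → ℚ[X]
  | 0 => 1
  | m + 1 => C (1 / (((m : ℚ) + 1) * (m + 2))) * (C ((m : ℚ) * (m + 1)) - X * (X + 1)) *
      centralFactorial m

theorem mul_centralFactorial (m : ℕ) :
    X * (X + 1) * centralFactorial m = ((m : ℚ) * (m + 1)) • centralFactorial m -
      (((m : ℚ) + 1) * (m + 2)) • centralFactorial (m + 1) := by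
  have h0 : ((m : ℚ) + 1) * (m + 2) ≠ 0 := by positivity
  have h : C (((m : ℚ) + 1) * (m + 2)) * C (1 / (((m : ℚ) + 1) * (m + 2))) = 1 := by
    rw [← C_mul, mul_one_div_cancel h0, C_1]
  rw [smul_eq_C_mul, smul_eq_C_mul, centralFactorial]
  linear_combination ((C ((m : ℚ) * (m + 1)) - X * (X + 1)) * centralFactorial m) * h

theorem sub_mul_centralFactorial_succ (m : ℕ) :
    (X - C ((m : ℚ) + 1)) * centralFactorial (m + 1) = C (1 / (((m : ℚ) + 1) * (m + 2))) *
      (C (((m : ℚ) + 1) ^ 2) - X ^ 2) * ((X - C (m : ℚ)) * centralFactorial m) := by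
  rw [centralFactorial]
  simp only [C_mul, C_add, C_1, C_pow]
  ring

/-- Up to a constant, the central factorial is the product of the consecutive factors from `X - m +
1` to `X + m`. Adjoining `X - m` gives `2 m + 1` consecutive factors, and the shift trades `X - m`
for `X + m + 1`. -/
theorem comp_sub_mul_centralFactorial (m : ℕ) :
    ((X - C (m : ℚ)) * centralFactorial m).comp (X + 1) =
      (X + C ((m : ℚ) + 1)) * centralFactorial m := by
  induction m with
  | zero => simp [centralFactorial]
  | succ m ih =>
    rw [Nat.cast_succ, sub_mul_centralFactorial_succ, mul_comp, ih, centralFactorial]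
    simp only [mul_comp, sub_comp, C_comp, pow_comp, X_comp, C_mul, C_add, C_1, C_pow, add_comp, one_comp]
    ring

theorem coeff_one_sub_mul_centralFactorial (m : ℕ) :
    ((X - C (m : ℚ)) * centralFactorial m).coeff 1 = 1 / ((m : ℚ) + 1) := by
  induction m with
  | zero => simp [centralFactorial]
  | succ m ih =>
    rw [Nat.cast_succ, sub_mul_centralFactorial_succ, mul_assoc, coeff_C_mul, sub_mul, coeff_sub,
      coeff_C_mul, ih, coeff_X_pow_mul', if_neg (by norm_num)]
    field_simp
    ring

/-- Since `2 X + 1 = (X - m) + (X + m + 1)`, the shift rule exhibits the argument as `f (X) + f (X +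
1)` explicitly. -/
theorem genocchiFunctional_centralFactorial (m : ℕ) :
    genocchiFunctional ((2 * X + 1) * centralFactorial m) = 1 / ((m : ℚ) + 1) := by
  rw [← coeff_one_sub_mul_centralFactorial, ← genocchiFunctional_shiftSum, shiftSum_apply,
    comp_sub_mul_centralFactorial]
  congr 1
  simp only [C_add, C_1]
  ring

/-- The signed integers `e n m` with `e n 0 = (-1) ^ n h n`, where `h` is the sequence of the
normalized median Genocchi numbers. -/
def signedGenocchi : ℕ → ℕ → ℤ
  | 0, _ => 1
  | n + 1, m => (m + 1).choose 2 * signedGenocchi n m -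
      (m + 2).choose 2 * signedGenocchi n (m + 1)

/-- The first multiplication by `X (X + 1)` gives `m - (m + 1) = -1`. Each later one brings
coefficients `m (m + 1)` and `(m + 1) (m + 2)`, twice the binomials of `signedGenocchi`; this is the
origin of the power of `2` dividing the median Genocchi numbers. -/
theorem genocchiFunctional_pow_mul_centralFactorial (n m : ℕ) :
    genocchiFunctional ((2 * X + 1) * ((X * (X + 1)) ^ (n + 1) * centralFactorial m)) =
      - (2 ^ n * (signedGenocchi n m : ℚ)) := by
  induction n generalizing m with
  | zero =>
    rw [zero_add, pow_one, mul_centralFactorial, mul_sub, mul_smul_comm, mul_smul_comm, map_sub,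
      map_smul, map_smul, genocchiFunctional_centralFactorial,
      genocchiFunctional_centralFactorial, signedGenocchi, Nat.cast_succ, smul_eq_mul, smul_eq_mul]
    field_simp
    push_cast
    ring
  | succ n ih =>
    have c1 : (((m + 1).choose 2 : ℕ) : ℚ) = (m + 1) * m / 2 := by
      rw [Nat.cast_choose_two]; push_cast; ring
    have c2 : (((m + 2).choose 2 : ℕ) : ℚ) = (m + 2) * (m + 1) / 2 := by
      rw [Nat.cast_choose_two]; push_cast; ring
    rw [pow_succ, mul_assoc, mul_centralFactorial, mul_sub, mul_sub, mul_smul_comm, mul_smul_comm,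
      mul_smul_comm, mul_smul_comm, map_sub, map_smul, map_smul, ih, ih, signedGenocchi,
      smul_eq_mul, smul_eq_mul]
    push_cast
    rw [c1, c2]
    ring

theorem genocchiTable_center (n : ℕ) :
    2 * genocchiTable (n + 1) (n + 2) = - (2 ^ n * (signedGenocchi n 0 : ℚ)) := by
  have h : (2 * X + 1) * ((X * (X + 1)) ^ (n + 1) * centralFactorial 0) =
      -- This is `2 X + 1 = 2 (X + 1) - 1`; the subtracted term lies on the vanishing diagonal.
      (2 : ℚ) • (X ^ (n + 1) * (X + 1) ^ (n + 2)) - X ^ (n + 1) * (X + 1) ^ (n + 1) := by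
    rw [centralFactorial, smul_eq_C_mul, map_ofNat, mul_pow]
    ring
  have h1 := genocchiFunctional_pow_mul_centralFactorial n 0
  rw [h, map_sub, map_smul] at h1
  change 2 * genocchiTable (n + 1) (n + 2) - genocchiTable (n + 1) (n + 1) = _ at h1
  rwa [genocchiTable_self, sub_zero] at h1

/-- Rows `2 p` and `2 p + 1` lie on the lines of total degree `2 p + 1` and `2 p + 2` of the table,
and both Seidel rules become `genocchiTable_succ`, with the sign absorbing the change of direction.
The zero ending an even row is the value at an odd power of `X + 1`; the zero starting an odd row is
a diagonal value. -/
theorem seidel_eq_genocchiTable (p : ℕ) (hp : 1 ≤ p) :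
    (∀ i l, 1 ≤ l → i + l = p + 1 →
      (seidel (2 * p) l : ℚ) = 2 * (-1) ^ p * genocchiTable i (p + l)) ∧
    (∀ l i, i + l = p + 1 →
      (seidel (2 * p + 1) l : ℚ) = 2 * (-1) ^ p * genocchiTable i (p + 1 + l)) := by
  have step : ∀ p, 1 ≤ p → (∀ i l, 1 ≤ l → i + l = p + 1 →
      (seidel (2 * p) l : ℚ) = 2 * (-1) ^ p * genocchiTable i (p + l)) →
      (∀ l i, i + l = p + 1 →
        (seidel (2 * p + 1) l : ℚ) = 2 * (-1) ^ p * genocchiTable i (p + 1 + l)) := by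
    intro p hp hE l
    induction l with
    | zero =>
      intro i hi
      rw [seidel_odd_zero p hp, show i = p + 1 by omega, add_zero, genocchiTable_self]
      simp
    | succ l ih =>
      intro i hi
      rw [seidel_odd p (l + 1) hp (by omega) (by omega), Nat.add_sub_cancel, Nat.cast_add,
        ih (i + 1) (by omega), hE i (l + 1) (by omega) hi, ← add_assoc (p + 1) l 1,
        genocchiTable_succ, show p + (l + 1) = p + 1 + l by ring]
      ring
  induction p, hp using Nat.le_induction with
  | base =>
    have hE : ∀ i l, 1 ≤ l → i + l = 1 + 1 →
        (seidel (2 * 1) l : ℚ) = 2 * (-1) ^ 1 * genocchiTable i (1 + l) := by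
      intro i l hl hil
      obtain rfl | rfl : l = 1 ∨ l = 2 := by omega
      · obtain rfl : i = 1 := by omega
        have h := genocchiTable_center 0
        have h2 : seidel (2 * 1) 1 = 1 := by
          rw [seidel_even 1 1 le_rfl le_rfl, seidel_even_top 1 le_rfl]
          exact seidel_one_one
        rw [h2]
        simp only [signedGenocchi] at h
        norm_num at h ⊢
        linarith
      · obtain rfl : i = 0 := by omega
        rw [seidel_even_top 1 le_rfl, genocchiTable_zero_left (N := 1 + 2) ⟨1, rfl⟩ (by norm_num)]
        simp
    exact ⟨hE, step 1 le_rfl hE⟩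
  | succ p hp ih =>
    have hE : ∀ i l, 1 ≤ l → i + l = p + 1 + 1 →
        (seidel (2 * (p + 1)) l : ℚ) = 2 * (-1) ^ (p + 1) * genocchiTable i (p + 1 + l) := by
      -- Even rows are filled from the end `l = p + 1 + 1`, where `i = 0`, so the induction runs on
      -- `i`.
      intro i
      induction i with
      | zero =>
        intro l hl hil
        obtain rfl : l = p + 1 + 1 := by omega
        rw [seidel_even_top (p + 1) (by omega), genocchiTable_zero_left ⟨p + 1, by ring⟩ (by omega)]
        simp
      | succ i ihi =>
        intro l hl hil
        rw [seidel_even (p + 1) l hl (by omega), Nat.cast_add, ihi (l + 1) (by omega) (by omega),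
          show 2 * (p + 1) - 1 = 2 * p + 1 by omega, ih.2 l i (by omega), ← add_assoc (p + 1) l 1,
          genocchiTable_succ]
        ring
    exact ⟨hE, step (p + 1) (by omega) hE⟩

theorem medianGenocchi_eq (n : ℕ) :
    (medianGenocchi n : ℤ) = 2 ^ n * ((-1) ^ n * signedGenocchi n 0) := by
  have h := (seidel_eq_genocchiTable (n + 1) (by omega)).1 (n + 1) 1 le_rfl rfl
  have h1 := genocchiTable_center n
  rw [show n + 1 + 1 = n + 2 by ring] at h
  have h2 : (medianGenocchi n : ℚ) = 2 ^ n * ((-1) ^ n * signedGenocchi n 0) := by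
    rw [medianGenocchi, show 2 * n + 2 = 2 * (n + 1) by ring, h, pow_succ]
    linear_combination (-1) ^ n * (-1) * h1
  exact_mod_cast h2

theorem two_pow_mul_normalizedMedianGenocchi (n : ℕ) :
    medianGenocchi n = 2 ^ n * normalizedMedianGenocchi n := by
  have h : (2 ^ n : ℕ) ∣ medianGenocchi n := by
    have : ((2 ^ n : ℕ) : ℤ) ∣ (medianGenocchi n : ℤ) := by
      rw [medianGenocchi_eq]
      push_cast
      exact dvd_mul_right _ _
    exact_mod_cast this
  exact (Nat.mul_div_cancel' h).symm

theorem signedGenocchi_zero_eq (n : ℕ) :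
    signedGenocchi n 0 = (-1) ^ n * normalizedMedianGenocchi n := by
  have h := medianGenocchi_eq n
  rw [two_pow_mul_normalizedMedianGenocchi, Nat.cast_mul] at h
  push_cast at h
  have h2 := mul_left_cancel₀ (pow_ne_zero n two_ne_zero) h
  rw [h2, ← mul_assoc, ← mul_pow]
  norm_num

/-! ### The linear coefficient of the weight. -/

theorem eval_spinMoment (n m : ℕ) :
    (spinMoment n (m + 1)).eval 0 = (signedGenocchi n m : ℂ) := by
  induction n generalizing m with
  | zero => simp [spinMoment, signedGenocchi]
  | succ n ih =>
    have c1 : (((m + 1).choose 2 : ℕ) : ℂ) = (m + 1) * m / 2 := by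
      rw [Nat.cast_choose_two]; push_cast; ring
    have c2 : (((m + 2).choose 2 : ℕ) : ℂ) = (m + 2) * (m + 1) / 2 := by
      rw [Nat.cast_choose_two]; push_cast; ring
    rw [spinMoment, signedGenocchi]
    simp only [eval_add, eval_mul, eval_sub, eval_X, eval_C, eval_pow, ih]
    push_cast
    rw [c1, c2]
    ring

/-- The polynomial `X (X + 1)` vanishes at `0` with derivative `1`, so the substitution preserves
the expansion to first order. -/
theorem coeff_comp_mul_add_one {R : Type*} [CommRing R] (p : R[X]) :
    (p.comp (X * (X + 1))).coeff 0 = p.coeff 0 ∧ (p.comp (X * (X + 1))).coeff 1 = p.coeff 1 := by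
  have h : ∀ q : R[X], q.coeff 1 = (derivative q).eval 0 := fun q => by
    rw [← coeff_zero_eq_eval_zero, coeff_derivative]
    simp
  constructor
  · simp [coeff_zero_eq_eval_zero, eval_comp]
  · rw [h, h, derivative_comp]
    simp [eval_comp]

theorem coeff_weight_completeDiagram {c : Finset Chord → Chord} (hc : IsChordChoice c) (n : ℕ) :
    (weight c (n + 1) (completeDiagram (n + 1))).coeff 0 = 0 ∧
    (weight c (n + 1) (completeDiagram (n + 1))).coeff 1 =
      (-1) ^ n * normalizedMedianGenocchi n := by
  have h := coeff_comp_mul_add_one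
    ((weight c (n + 1) (completeDiagram (n + 1))).map (Int.castRingHom ℂ))
  -- The first step, at `k = 0`, supplies the factor `X`; to first order only the branch to `k = 1`
  -- survives, evaluated at `j = 0`.
  have hd : spinMoment (n + 1) 0 = X * (spinMoment n 1 + X * spinMoment n 0) := by
    rw [spinMoment]
    simp
    ring
  rw [weight_completeDiagram_comp hc, hd, coeff_X_mul_zero, coeff_map, coeff_map, coeff_X_mul,
    coeff_add, coeff_X_mul_zero, add_zero, coeff_zero_eq_eval_zero (spinMoment n 1), eval_spinMoment] at h
  simp only [eq_intCast] at h
  rw [← signedGenocchi_zero_eq]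
  exact ⟨by exact_mod_cast h.1.symm, by exact_mod_cast h.2.symm⟩

theorem X_sq_dvd_sub_of_coeff {R : Type*} [CommRing R] {p q : R[X]} {r : R} (h0 : p.coeff 0 = 0)
    (h1 : p.coeff 1 = r) (hq : q = C r * X) : X ^ 2 ∣ p - q := by
  rw [X_pow_dvd_iff, hq]
  intro d hd
  interval_cases d
  · simp [h0]
  · simp [h1]

theorem mainTheorem2 (c : Finset Chord → Chord) (hc : IsChordChoice c) (n : ℕ) (hn : 1 ≤ n) :
    2 ^ (n - 1) ∣ medianGenocchi (n - 1) ∧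
    (X ^ 2 : ℤ[X]) ∣ weight c n (completeDiagram n) -
      (-1) ^ (n - 1) * C (normalizedMedianGenocchi (n - 1) : ℤ) * X ∧
    (X ^ 2 : ℚ[X]) ∣ sl2Weight c n (completeDiagram n) -
      (-1) ^ (n - 1) * C (medianGenocchi (n - 1) : ℚ) * X := by
  obtain ⟨n, rfl⟩ := Nat.exists_eq_add_of_le' hn
  rw [Nat.add_sub_cancel]
  obtain ⟨h0, h1⟩ := coeff_weight_completeDiagram hc n
  refine ⟨⟨_, two_pow_mul_normalizedMedianGenocchi n⟩,
    X_sq_dvd_sub_of_coeff h0 h1 (by simp), X_sq_dvd_sub_of_coeff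
      (r := (-1) ^ n * (medianGenocchi n : ℚ)) ?_ ?_ (by simp)⟩
  · rw [sl2Weight, coeff_C_mul, comp_C_mul_X_coeff, coeff_map, h0]
    simp
  -- The order is `n + 1`, and halving the variable leaves `2 ^ (n + 1) / 2 = 2 ^ n`, exactly the
  -- normalization of the median Genocchi numbers.
  · rw [sl2Weight, coeff_C_mul, comp_C_mul_X_coeff, coeff_map, h1,
      two_pow_mul_normalizedMedianGenocchi]
    push_cast
    simp only [map_mul, map_pow, map_neg, map_one, map_natCast]
    ring
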